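/- Let $d,N\geq 1$ be integers and let $A,B\in\mathbb C^{N\times N}$ and $S\in\mathbb R^{d\times d}$ be matrices such that - $A$ and $B$ are simultaneously diagonalizable: there is an invertible $Y\in\mathbb C^{N\times N}$ (fixed in the following) such that $Y^{-1}AY$ and $Y^{-1}BY$ are diagonal, - every eigenvalue of $A$ has positive real part, - $S$ is skew-symmetric, $S^{T}=-S$. Let $|\cdot|$ denote the Euclidean norm of vectors and the spectral norm of matrices. For a square matrix $C$ with spectrum $\sigma(C)$ put $\rho(C)=\max_{\mu\in\sigma(C)}|\mu|$ and $s(C)=\max_{\mu\in\sigma(C)}\operatorname{Re}\mu$, and define $$a_{\min}=\rho(A^{-1})^{-1},\quad a_{\max}=\rho(A),\quad a_0=-s(-A),\quad b_0=-s(-B),\quad a_1=\frac{a_{\max}^2}{a_{\min}a_0},\quad \kappa=|Y|\,|Y^{-1}|,$$ $$M_{\mathrm b}=\kappa\,a_1^{d/2},\qquad \omega_{\mathrm b}=-b_0 .$$ For $x,\xi\in\mathbb R^d$ and $t>0$ let $$H(x,\xi,t)=(4\pi tA)^{-d/2}\exp\!\Big(-Bt-(4tA)^{-1}\,|e^{tS}x-\xi|^2\Big)\in\mathbb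 C^{N\times N},$$ where the power is the principal one, and let $[T(t)v](x)=\int_{\mathbb R^d}H(x,\xi,t)v(\xi)\,d\xi$ for $t>0$ and $T(0)v=v$. Let $C_{\mathrm b}(\mathbb R^d,\mathbb C^N)$ be the space of bounded continuous functions with $\|v\|_{C_{\mathrm b}}=\sup_{x}|v(x)|$, and let $C_{\mathrm{rub}}(\mathbb R^d,\mathbb C^N)$ be its closed subspace of all uniformly continuous $v$ with $\lim_{t\to0}\sup_{x\in\mathbb R^d}|v(e^{-tS}x)-v(x)|=0$. The operators $T(t)$, $t\geq0$, map $C_{\mathrm{rub}}$ into itself. Let $A_{\mathrm b}$ be the infinitesimal generator of $(T(t))_{t\ge 0}$ on $C_{\mathrm{rub}}(\mathbb R^d,\mathbb C^N)$: its domain $\mathcal D(A_{\mathrm b})$ consists of all $v\in C_{\mathrm{rub}}$ for which $A_{\mathrm b}v:=\lim_{t\downarrow0}\frac1t(T(t)v-v)$ exists in $C_{\mathrm{rub}}$. Then for every $\lambda\in\mathbb C$ with $\operatorname{Re}\lambda>\omega_{\mathrm b}$ and every $g\in C_{\mathrm{rub}}(\mathbb R^d,\mathbb C^N)$ the resolvent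 equation $$(\lambda I-A_{\mathrm b})v=g$$ has a unique solution $v_\star\in\mathcal D(A_{\mathrm b})$. It is given by $$v_\star=\int_0^\infty e^{-\lambda t}\,T(t)g\,dt=\int_0^\infty e^{-\lambda t}\int_{\mathbb R^d}H(\cdot,\xi,t)\,g(\xi)\,d\xi\,dt,$$ where the first integral converges absolutely in $C_{\mathrm{rub}}(\mathbb R^d,\mathbb C^N)$ and the second one is understood pointwise (all integrals being absolutely convergent), and it satisfies $$\|v_\star\|_{C_{\mathrm b}}\leq\frac{M_{\mathrm b}}{\operatorname{Re}\lambda-\omega_{\mathrm b}}\,\|g\|_{C_{\mathrm b}} .$$ -/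

import Mathlib

open MeasureTheory Filter Topology Set
open scoped BoundedContinuousFunction

namespace OrnsteinUhlenbeck

/-- `ℝ^d` with the Euclidean norm. -/
abbrev RSpace (d : ℕ) : Type := EuclideanSpace ℝ (Fin d)

/-- `ℂ^N` with the Euclidean norm. -/
abbrev CSpace (N : ℕ) : Type := EuclideanSpace ℂ (Fin N)

/-- `N × N` complex matrices. -/
abbrev CMat (N : ℕ) : Type := Matrix (Fin N) (Fin N) ℂ

/-- `d × d` real matrices. -/
abbrev RMat (d : ℕ) : Type := Matrix (Fin d) (Fin d) ℝ

section Assumptions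

/-- The standing assumptions: `Y` is invertible and diagonalizes both `A` and `B`,
all eigenvalues of `A` have positive real part, and `S` is skew-symmetric. -/
structure Assumptions {d N : ℕ} (A B Y : CMat N) (S : RMat d) : Prop where
  isUnit_Y : IsUnit Y
  diag_A : (Y⁻¹ * A * Y).IsDiag
  diag_B : (Y⁻¹ * B * Y).IsDiag
  spec_A : ∀ μ ∈ spectrum ℂ A, 0 < μ.re
  skew_S : S.transpose = -S

end Assumptions

section Constants

/-- The spectral radius `ρ(C) = max {|μ| : μ ∈ σ(C)}`. -/
noncomputable def specRadius {N : ℕ} (C : CMat N) : ℝ :=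
  sSup ((fun μ : ℂ => ‖μ‖) '' spectrum ℂ C)

/-- The spectral abscissa `s(C) = max {Re μ : μ ∈ σ(C)}`. -/
noncomputable def specAbscissa {N : ℕ} (C : CMat N) : ℝ :=
  sSup (Complex.re '' spectrum ℂ C)

/-- The spectral norm (the operator norm for the Euclidean norm) of a matrix. -/
noncomputable def specNorm {N : ℕ} (C : CMat N) : ℝ :=
  ‖Matrix.toEuclideanCLM (n := Fin N) (𝕜 := ℂ) C‖

/-- The condition number `|C| |C⁻¹|`. -/
noncomputable def condNumber {N : ℕ} (C : CMat N) : ℝ := specNorm C * specNorm C⁻¹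

/-- `a_min = ρ(A⁻¹)⁻¹`. -/
noncomputable def aMin {N : ℕ} (A : CMat N) : ℝ := (specRadius A⁻¹)⁻¹

/-- `a_max = ρ(A)`. -/
noncomputable def aMax {N : ℕ} (A : CMat N) : ℝ := specRadius A

/-- `a_0 = -s(-A)`. -/
noncomputable def aZero {N : ℕ} (A : CMat N) : ℝ := -specAbscissa (-A)

/-- `b_0 = -s(-B)`. -/
noncomputable def bZero {N : ℕ} (B : CMat N) : ℝ := -specAbscissa (-B)

/-- `a_1 = a_max² / (a_min a_0)`. -/
noncomputable def aOne {N : ℕ} (A : CMat N) : ℝ := aMax A ^ 2 / (aMin A * aZero A)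

/-- `M_b = κ a_1^{d/2}` with `κ = |Y| |Y⁻¹|`. -/
noncomputable def Mb {N : ℕ} (d : ℕ) (A Y : CMat N) : ℝ :=
  condNumber Y * aOne A ^ ((d : ℝ) / 2)

/-- `ω_b = -b_0`. -/
noncomputable def omegaB {N : ℕ} (B : CMat N) : ℝ := -bZero B

end Constants

section Kernel

/-- The principal power `C^s` of a diagonalizable matrix `C`: the value at `C` of the polynomial
that interpolates the principal branch `z ↦ z^s` at the eigenvalues of `C`. -/
noncomputable def matrixCpow {N : ℕ} (C : CMat N) (s : ℂ) : CMat N :=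
  Polynomial.aeval C (Lagrange.interpolate C.charpoly.roots.toFinset id (fun z : ℂ => z ^ s))

theorem aeval_conj_diagonal {N : ℕ} (Y : CMat N) (hY : IsUnit Y) (a : Fin N → ℂ)
    (p : Polynomial ℂ) :
    Polynomial.aeval (Y * Matrix.diagonal a * Y⁻¹) p
      = Y * Matrix.diagonal (fun i => p.eval (a i)) * Y⁻¹ := by
  have hdet : IsUnit Y.det := (Matrix.isUnit_iff_isUnit_det Y).1 hY
  have hYY : Y⁻¹ * Y = 1 := Matrix.nonsing_inv_mul Y hdet
  have hYY' : Y * Y⁻¹ = 1 := Matrix.mul_nonsing_inv Y hdet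
  have hmul : ∀ u v : Fin N → ℂ, (Y * Matrix.diagonal u * Y⁻¹) * (Y * Matrix.diagonal v * Y⁻¹)
      = Y * Matrix.diagonal (fun i => u i * v i) * Y⁻¹ := by
    intro u v
    calc _ = Y * Matrix.diagonal u * (Y⁻¹ * Y) * Matrix.diagonal v * Y⁻¹ := by
            simp only [mul_assoc]
      _ = Y * (Matrix.diagonal u * Matrix.diagonal v) * Y⁻¹ := by
            rw [hYY]; simp only [mul_assoc, one_mul]
      _ = _ := by rw [Matrix.diagonal_mul_diagonal]
  have hconst : ∀ c : ℂ, Y * Matrix.diagonal (fun _ : Fin N => c) * Y⁻¹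
      = algebraMap ℂ (CMat N) c := by
    intro c
    have : (Matrix.diagonal (fun _ : Fin N => c)) = c • (1 : CMat N) := by
      rw [Matrix.smul_one_eq_diagonal]
    rw [this, mul_smul_comm, smul_mul_assoc, mul_one, hYY', Algebra.algebraMap_eq_smul_one]
  induction p using Polynomial.induction_on with
  | C c => simp [hconst]
  | add p q hp hq =>
    rw [map_add, hp, hq, ← add_mul, ← mul_add, Matrix.diagonal_add]
    simp
  | monomial n c h =>
    rw [pow_succ, ← mul_assoc, map_mul, h, Polynomial.aeval_X, hmul]
    simp

/-- On diagonalizable matrices `matrixCpow` is the principal power taken on the eigenvalues. -/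
theorem matrixCpow_conj_diagonal {N : ℕ} (Y : CMat N) (hY : IsUnit Y) (a : Fin N → ℂ) (s : ℂ) :
    matrixCpow (Y * Matrix.diagonal a * Y⁻¹) s
      = Y * Matrix.diagonal (fun i => a i ^ s) * Y⁻¹ := by
  have hch : (Y * Matrix.diagonal a * Y⁻¹).charpoly = (Matrix.diagonal a).charpoly := by
    obtain ⟨U, rfl⟩ := hY
    exact Matrix.charpoly_units_conj U _
  rw [matrixCpow, aeval_conj_diagonal Y hY, hch]
  congr 3
  funext i
  have hi : a i ∈ (Matrix.diagonal a).charpoly.roots.toFinset := by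
    rw [Matrix.charpoly_diagonal, Multiset.mem_toFinset, Polynomial.mem_roots']
    refine ⟨Finset.prod_ne_zero_iff.2 fun j _ => Polynomial.X_sub_C_ne_zero _, ?_⟩
    rw [Polynomial.IsRoot, Polynomial.eval_prod]
    exact Finset.prod_eq_zero (Finset.mem_univ i) (by simp)
  exact Lagrange.eval_interpolate_at_node _ (Function.injective_id.injOn) hi

/-- The rotation `x ↦ e^{tS} x` of `ℝ^d`. -/
noncomputable def rot {d : ℕ} (S : RMat d) (t : ℝ) : RSpace d →L[ℝ] RSpace d :=
  Matrix.toEuclideanCLM (n := Fin d) (𝕜 := ℝ) (NormedSpace.exp (t • S))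

/-- The kernel `K(ψ, t) = (4πtA)^{-d/2} exp(-Bt - (4tA)⁻¹ |ψ|²)`. -/
noncomputable def kernelK {d N : ℕ} (A B : CMat N) (ψ : RSpace d) (t : ℝ) : CMat N :=
  matrixCpow ((4 * Real.pi * t : ℂ) • A) (-(d : ℂ) / 2) *
    NormedSpace.exp (-((t : ℂ) • B) - ((‖ψ‖ ^ 2 : ℝ) : ℂ) • ((4 * t : ℂ) • A)⁻¹)

/-- The heat kernel matrix
`H(x, ξ, t) = (4πtA)^{-d/2} exp(-Bt - (4tA)⁻¹ |e^{tS} x - ξ|²)`. -/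
noncomputable def heatKernel {d N : ℕ} (A B : CMat N) (S : RMat d) (x ξ : RSpace d) (t : ℝ) :
    CMat N :=
  kernelK A B (rot S t x - ξ) t

/-- A complex matrix acting on `ℂ^N`. -/
noncomputable abbrev act {N : ℕ} (C : CMat N) : CSpace N →L[ℂ] CSpace N :=
  Matrix.toEuclideanCLM (n := Fin N) (𝕜 := ℂ) C

/-- The function `T(t)v`: `[T(t)v](x) = ∫ H(x, ξ, t) v(ξ) dξ` for `t > 0`, and `T(0)v = v`.
Negative times play no role. -/
noncomputable def semigroupFun {d N : ℕ} (A B : CMat N) (S : RMat d) (t : ℝ)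
    (v : RSpace d → CSpace N) (x : RSpace d) : CSpace N :=
  if 0 < t then ∫ ξ, act (heatKernel A B S x ξ t) (v ξ) else v x

end Kernel

section Crub

/-- `C_rub(ℝ^d, F)` as a subspace of `C_b(ℝ^d, F)` (with the supremum norm): the bounded
uniformly continuous `v` with `sup_x |v(e^{-tS} x) - v(x)| → 0` as `t → 0`. -/
noncomputable def Crub {d : ℕ} (S : RMat d) (F : Type*) [NormedAddCommGroup F] [NormedSpace ℂ F] :
    Submodule ℂ (RSpace d →ᵇ F) where
  carrier := {v | UniformContinuous v ∧
    TendstoUniformly (fun (t : ℝ) (x : RSpace d) => v (rot S (-t) x)) v (𝓝 0)}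
  add_mem' := fun hu hv => ⟨hu.1.add hv.1, hu.2.add hv.2⟩
  zero_mem' := ⟨uniformContinuous_const, fun _ hU => Eventually.of_forall fun _ _ =>
    refl_mem_uniformity hU⟩
  smul_mem' := fun c _ hv => ⟨hv.1.const_smul c,
    (uniformContinuous_const_smul c).comp_tendstoUniformly hv.2⟩

/-- `C_rub` is closed in `C_b`. -/
theorem isClosed_Crub {d : ℕ} (S : RMat d) (F : Type*) [NormedAddCommGroup F] [NormedSpace ℂ F] :
    IsClosed (Crub S F : Set (RSpace d →ᵇ F)) := by
  rw [← isSeqClosed_iff_isClosed]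
  intro u v hu huv
  rw [BoundedContinuousFunction.tendsto_iff_tendstoUniformly] at huv
  refine ⟨huv.uniformContinuous (Eventually.of_forall fun n => (hu n).1).frequently, ?_⟩
  rw [Metric.tendstoUniformly_iff] at huv ⊢
  intro ε hε
  obtain ⟨n, hn⟩ := (huv (ε / 3) (by positivity)).exists
  filter_upwards [Metric.tendstoUniformly_iff.1 (hu n).2 (ε / 3) (by positivity)] with t ht x
  have h1 := hn x
  have h2 := hn (rot S (-t) x)
  have h3 := ht x
  rw [dist_comm] at h2
  linarith [dist_triangle4 (v x) (u n x) (u n (rot S (-t) x)) (v (rot S (-t) x))]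

/-- `C_rub` is a Banach space. -/
instance {d : ℕ} (S : RMat d) (F : Type*) [NormedAddCommGroup F] [NormedSpace ℂ F]
    [CompleteSpace F] : CompleteSpace (Crub S F) :=
  (isClosed_Crub S F).completeSpace_coe

end Crub

section Semigroup

variable {d N : ℕ} {A B Y : CMat N} {S : RMat d}

theorem rot_neg_star (hS : S.transpose = -S) (t : ℝ) : star (rot S t) = rot S (-t) := by
  unfold rot
  rw [← map_star, Matrix.star_eq_conjTranspose, Matrix.conjTranspose_eq_transpose_of_trivial,
    ← Matrix.exp_transpose, Matrix.transpose_smul, hS, smul_neg, neg_smul]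

theorem rot_mul (s t : ℝ) : rot S s * rot S t = rot S (s + t) := by
  unfold rot
  rw [← map_mul, ← Matrix.exp_add_of_commute _ _
    (((Commute.refl S).smul_left s).smul_right t), add_smul]

theorem rot_rot (s t : ℝ) (x : RSpace d) : rot S s (rot S t x) = rot S (s + t) x := by
  rw [← rot_mul]; rfl

theorem rot_zero (x : RSpace d) : rot S 0 x = x := by
  simp [rot]

theorem norm_rot (hS : S.transpose = -S) (t : ℝ) (x : RSpace d) : ‖rot S t x‖ = ‖x‖ := by
  refine (rot S t).norm_map_iff_adjoint_comp_self.2 ?_ x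
  rw [← ContinuousLinearMap.star_eq_adjoint, rot_neg_star hS]
  ext1 y
  change rot S (-t) (rot S t y) = y
  rw [rot_rot, neg_add_cancel, rot_zero]

/-- The rotation as a linear isometry equivalence, for skew-symmetric `S`. -/
noncomputable def rotEquiv (hS : S.transpose = -S) (t : ℝ) : RSpace d ≃ₗᵢ[ℝ] RSpace d where
  toFun := rot S t
  map_add' := map_add _
  map_smul' := map_smul _
  invFun := rot S (-t)
  left_inv := fun x => by rw [rot_rot, neg_add_cancel, rot_zero]
  right_inv := fun x => by rw [rot_rot, add_neg_cancel, rot_zero]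
  norm_map' := norm_rot hS t

theorem Assumptions.exists_diag (h : Assumptions A B Y S) :
    ∃ a b : Fin N → ℂ, A = Y * Matrix.diagonal a * Y⁻¹ ∧ B = Y * Matrix.diagonal b * Y⁻¹ ∧
      ∀ i, 0 < (a i).re := by
  have hdet : IsUnit Y.det := (Matrix.isUnit_iff_isUnit_det Y).1 h.isUnit_Y
  have hYY' : Y * Y⁻¹ = 1 := Matrix.mul_nonsing_inv Y hdet
  have key : ∀ C : CMat N, (Y⁻¹ * C * Y).IsDiag →
      C = Y * Matrix.diagonal (Y⁻¹ * C * Y).diag * Y⁻¹ := by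
    intro C hC
    rw [hC.diagonal_diag]
    calc C = (Y * Y⁻¹) * C * (Y * Y⁻¹) := by rw [hYY', one_mul, mul_one]
      _ = _ := by simp only [mul_assoc]
  have hspec : ∀ a : Fin N → ℂ, spectrum ℂ (Y * Matrix.diagonal a * Y⁻¹) = Set.range a := by
    intro a
    obtain ⟨U, rfl⟩ := h.isUnit_Y
    rw [← Matrix.coe_units_inv, spectrum.units_conjugate, spectrum_diagonal]
  refine ⟨_, _, key A h.diag_A, key B h.diag_B, fun i => h.spec_A _ ?_⟩
  have hA := hspec (Y⁻¹ * A * Y).diag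
  rw [← key A h.diag_A] at hA
  rw [hA]
  exact ⟨i, rfl⟩

theorem inv_conj_diagonal (hY : IsUnit Y) (a : Fin N → ℂ) (ha : ∀ i, a i ≠ 0) :
    (Y * Matrix.diagonal a * Y⁻¹)⁻¹ = Y * Matrix.diagonal (fun i => (a i)⁻¹) * Y⁻¹ := by
  have hdet : IsUnit Y.det := (Matrix.isUnit_iff_isUnit_det Y).1 hY
  have hYY : Y⁻¹ * Y = 1 := Matrix.nonsing_inv_mul Y hdet
  have hYY' : Y * Y⁻¹ = 1 := Matrix.mul_nonsing_inv Y hdet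
  refine Matrix.inv_eq_right_inv ?_
  calc _ = Y * Matrix.diagonal a * (Y⁻¹ * Y) * Matrix.diagonal (fun i => (a i)⁻¹) * Y⁻¹ := by
          simp only [mul_assoc]
    _ = Y * (Matrix.diagonal a * Matrix.diagonal (fun i => (a i)⁻¹)) * Y⁻¹ := by
          rw [hYY]; simp only [mul_assoc, one_mul]
    _ = 1 := by
          rw [Matrix.diagonal_mul_diagonal]
          simp [ha, hYY']

/-- The kernel in diagonalized form. -/
theorem kernelK_eq {a b : Fin N → ℂ} (hY : IsUnit Y) (hA : A = Y * Matrix.diagonal a * Y⁻¹)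
    (hB : B = Y * Matrix.diagonal b * Y⁻¹) (ha : ∀ i, a i ≠ 0) {t : ℝ} (ht : 0 < t)
    (ψ : RSpace d) :
    kernelK A B ψ t = Y * Matrix.diagonal (fun i =>
      (4 * Real.pi * t * a i) ^ (-(d : ℂ) / 2) *
        Complex.exp (-(t * b i) - (‖ψ‖ ^ 2 : ℝ) * (4 * t * a i)⁻¹)) * Y⁻¹ := by
  have hdet : IsUnit Y.det := (Matrix.isUnit_iff_isUnit_det Y).1 hY
  have hYY : Y⁻¹ * Y = 1 := Matrix.nonsing_inv_mul Y hdet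
  have hsmul : ∀ (c : ℂ) (u : Fin N → ℂ), c • (Y * Matrix.diagonal u * Y⁻¹)
      = Y * Matrix.diagonal (fun i => c * u i) * Y⁻¹ := by
    intro c u
    rw [← smul_mul_assoc, ← mul_smul_comm, ← Matrix.diagonal_smul]
    rfl
  have hne : ∀ i, (4 * t : ℂ) * a i ≠ 0 := fun i =>
    mul_ne_zero (mul_ne_zero (by norm_num) (by exact_mod_cast ht.ne')) (ha i)
  have hexp : -((t : ℂ) • B) - ((‖ψ‖ ^ 2 : ℝ) : ℂ) • ((4 * t : ℂ) • A)⁻¹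
      = Y * Matrix.diagonal (fun i => -(t * b i) - (‖ψ‖ ^ 2 : ℝ) * (4 * t * a i)⁻¹) * Y⁻¹ := by
    rw [hA, hB, hsmul, hsmul, inv_conj_diagonal hY _ hne, hsmul]
    rw [← neg_mul, ← mul_neg, ← sub_mul, ← mul_sub, Matrix.diagonal_neg, Matrix.diagonal_sub]
  rw [kernelK, hexp, hA, hsmul, matrixCpow_conj_diagonal Y hY, Matrix.exp_conj _ _ hY,
    Matrix.exp_diagonal]
  calc _ = Y * Matrix.diagonal (fun i => (4 * Real.pi * t * a i) ^ (-(d : ℂ) / 2)) * (Y⁻¹ * Y) *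
        Matrix.diagonal (NormedSpace.exp
          (fun i => -(t * b i) - (‖ψ‖ ^ 2 : ℝ) * (4 * t * a i)⁻¹)) * Y⁻¹ := by
          simp only [mul_assoc]
    _ = _ := by
          rw [hYY, mul_one, mul_assoc Y, Matrix.diagonal_mul_diagonal]
          congr 3
          funext i
          rw [Pi.coe_exp, Complex.exp_eq_exp_ℂ]

theorem integrable_gaussian (d : ℕ) {z : ℂ} (hz : 0 < z.re) (c w : ℂ) :
    Integrable (fun ψ : RSpace d => c * Complex.exp (w - (‖ψ‖ ^ 2 : ℝ) * z)) := by
  have h1 := ((GaussianFourier.integrable_cexp_neg_mul_sq_norm_add (V := RSpace d) hz 0 0).const_mul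
    (Complex.exp w)).const_mul c
  refine h1.congr (Eventually.of_forall fun ψ => ?_)
  simp only [zero_mul, add_zero]
  rw [← Complex.exp_add]
  congr 2
  push_cast
  ring

theorem integrable_sum_smul {α E : Type*} [MeasurableSpace α] {μ : Measure α}
    [NormedAddCommGroup E] [NormedSpace ℂ E] (f : Fin N → α → ℂ) (hf : ∀ i, Integrable (f i) μ)
    (L : Fin N → E) : Integrable (fun x => ∑ i, f i x • L i) μ :=
  integrable_finsetSum _ fun i _ => (hf i).smul_const (L i)

theorem integrable_kernelK (h : Assumptions A B Y S) {t : ℝ} (ht : 0 < t) :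
    Integrable (fun ψ : RSpace d => act (kernelK A B ψ t)) := by
  obtain ⟨a, b, hA, hB, ha⟩ := h.exists_diag
  have ha' : ∀ i, a i ≠ 0 := fun i h0 => by simpa [h0] using ha i
  have hre : ∀ i, 0 < ((4 * t * a i : ℂ)⁻¹).re := by
    intro i
    rw [Complex.inv_re]
    have h1 : (4 * t * a i : ℂ).re = 4 * t * (a i).re := by
      have : (4 * t * a i : ℂ) = ((4 * t : ℝ) : ℂ) * a i := by push_cast; ring
      rw [this, Complex.re_ofReal_mul]
    refine div_pos (by rw [h1]; have := ha i; positivity) (Complex.normSq_pos.2 ?_)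
    exact mul_ne_zero (mul_ne_zero (by norm_num) (by exact_mod_cast ht.ne')) (ha' i)
  have hsum := integrable_sum_smul _ (fun i => integrable_gaussian d (hre i)
    ((4 * Real.pi * t * a i) ^ (-(d : ℂ) / 2)) (-(t * b i)))
    (fun i => act (Y * Matrix.single i i 1 * Y⁻¹))
  refine hsum.congr (Eventually.of_forall fun ψ => ?_)
  simp only
  rw [kernelK_eq h.isUnit_Y hA hB ha' ht, ← Matrix.sum_single_eq_diagonal, Finset.mul_sum,
    Finset.sum_mul]
  refine Eq.trans ?_ (map_sum (Matrix.toEuclideanCLM (n := Fin N) (𝕜 := ℂ)) _ _).symm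
  refine Finset.sum_congr rfl fun i _ => ?_
  refine (map_smul (Matrix.toEuclideanCLM (n := Fin N) (𝕜 := ℂ)) _ _).symm.trans ?_
  rw [← smul_mul_assoc, ← mul_smul_comm, Matrix.smul_single, smul_eq_mul, mul_one]

theorem integrable_act_apply {F : RSpace d → CSpace N →L[ℂ] CSpace N} (hF : Integrable F)
    (v : RSpace d →ᵇ CSpace N) (L : RSpace d → RSpace d) (hL : Continuous L) :
    Integrable (fun ψ => F ψ (v (L ψ))) := by
  refine (hF.norm.mul_const ‖v‖).mono' ?_ (Eventually.of_forall fun ψ => ?_)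
  · exact (ContinuousLinearMap.apply ℂ (CSpace N)).flip.aestronglyMeasurable_comp₂
      hF.aestronglyMeasurable (v.continuous.comp hL).aestronglyMeasurable
  · exact (ContinuousLinearMap.le_opNorm _ _).trans
      (mul_le_mul_of_nonneg_left (v.norm_coe_le_norm _) (norm_nonneg _))

theorem integrable_heatKernel (h : Assumptions A B Y S) {t : ℝ} (ht : 0 < t)
    (v : RSpace d →ᵇ CSpace N) (x : RSpace d) :
    Integrable (fun ξ => act (heatKernel A B S x ξ t) (v ξ)) :=
  integrable_act_apply ((integrable_kernelK h ht).comp_sub_left (rot S t x)) v id continuous_id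

theorem semigroupFun_eq {t : ℝ} (ht : 0 < t) (v : RSpace d → CSpace N) (x : RSpace d) :
    semigroupFun A B S t v x = ∫ ψ, act (kernelK A B ψ t) (v (rot S t x - ψ)) := by
  rw [semigroupFun, if_pos ht,
    ← integral_sub_left_eq_self (fun ξ => act (heatKernel A B S x ξ t) (v ξ)) volume (rot S t x)]
  simp [heatKernel]

/-- The kernel only depends on `|ψ|`. -/
theorem kernelK_rot (hS : S.transpose = -S) (s t : ℝ) (ψ : RSpace d) :
    kernelK A B (rot S s ψ) t = kernelK A B ψ t := by
  simp only [kernelK, norm_rot hS]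

theorem norm_semigroupFun_sub_le (h : Assumptions A B Y S) {t : ℝ} (ht : 0 < t)
    (u v : RSpace d →ᵇ CSpace N) (L : RSpace d → RSpace d) (hL : Continuous L)
    (x : RSpace d) (δ : ℝ)
    (hδ : ∀ ψ, ‖u (L ψ) - v (rot S t x - ψ)‖ ≤ δ) :
    ‖(∫ ψ, act (kernelK A B ψ t) (u (L ψ))) - semigroupFun A B S t v x‖
      ≤ (∫ ψ : RSpace d, ‖act (kernelK A B ψ t)‖) * δ := by
  have hK := integrable_kernelK h ht
  have h2 := integrable_act_apply hK v (fun ψ => rot S t x - ψ) (by fun_prop)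
  rw [semigroupFun_eq ht, ← integral_sub (integrable_act_apply hK u L hL) h2, ← integral_mul_const]
  refine norm_integral_le_of_norm_le (hK.norm.mul_const δ) (Eventually.of_forall fun ψ => ?_)
  rw [← map_sub]
  exact (ContinuousLinearMap.le_opNorm _ _).trans
    (mul_le_mul_of_nonneg_left (hδ ψ) (norm_nonneg _))

theorem norm_semigroupFun_le (h : Assumptions A B Y S) {t : ℝ} (ht : 0 < t)
    (v : RSpace d →ᵇ CSpace N) (x : RSpace d) :
    ‖semigroupFun A B S t v x‖ ≤ (∫ ψ : RSpace d, ‖act (kernelK A B ψ t)‖) * ‖v‖ := by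
  have := norm_semigroupFun_sub_le h ht 0 v id continuous_id x ‖v‖
    (fun ψ => by simpa using v.norm_coe_le_norm _)
  simpa using this

theorem uniformContinuous_semigroupFun (h : Assumptions A B Y S) {t : ℝ} (ht : 0 < t)
    (v : RSpace d →ᵇ CSpace N) (hv : UniformContinuous v) :
    UniformContinuous (semigroupFun A B S t v) := by
  set C := ∫ ψ : RSpace d, ‖act (kernelK A B ψ t)‖ with hC
  have hC0 : 0 ≤ C := integral_nonneg fun _ => norm_nonneg _
  rw [Metric.uniformContinuous_iff] at hv ⊢
  intro ε hε
  obtain ⟨δ, hδ, H⟩ := hv (ε / (C + 1)) (by positivity)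
  refine ⟨δ, hδ, fun {x y} hxy => ?_⟩
  rw [dist_eq_norm, semigroupFun_eq ht (x := x)]
  refine (norm_semigroupFun_sub_le h ht v v (fun ψ => rot S t x - ψ) (by fun_prop) y
    (ε / (C + 1)) fun ψ => ?_).trans_lt ?_
  · rw [← dist_eq_norm]
    refine (H ?_).le
    rwa [dist_sub_right, dist_eq_norm, ← map_sub, norm_rot h.skew_S, ← dist_eq_norm]
  · rw [← hC, mul_div_assoc', div_lt_iff₀ (by positivity)]
    nlinarith

theorem tendstoUniformly_semigroupFun (h : Assumptions A B Y S) {t : ℝ} (ht : 0 < t)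
    (v : RSpace d →ᵇ CSpace N)
    (hv : TendstoUniformly (fun (s : ℝ) (x : RSpace d) => v (rot S (-s) x)) v (𝓝 0)) :
    TendstoUniformly (fun (s : ℝ) (x : RSpace d) => semigroupFun A B S t v (rot S (-s) x))
      (semigroupFun A B S t v) (𝓝 0) := by
  set C := ∫ ψ : RSpace d, ‖act (kernelK A B ψ t)‖ with hC
  have hC0 : 0 ≤ C := integral_nonneg fun _ => norm_nonneg _
  rw [Metric.tendstoUniformly_iff] at hv ⊢
  intro ε hε
  filter_upwards [hv (ε / (C + 1)) (by positivity)] with s hs x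
  have hrot : semigroupFun A B S t v (rot S (-s) x)
      = ∫ ψ, act (kernelK A B ψ t) (v (rot S (-s) (rot S t x - ψ))) := by
    rw [semigroupFun_eq ht, ← (rotEquiv h.skew_S (-s)).measurePreserving.integral_comp
      (rotEquiv h.skew_S (-s)).toHomeomorph.measurableEmbedding]
    refine integral_congr_ae (Eventually.of_forall fun ψ => ?_)
    change act (kernelK A B (rot S (-s) ψ) t) (v (rot S t (rot S (-s) x) - rot S (-s) ψ)) = _
    simp only []
    rw [kernelK_rot h.skew_S, (rot S (-s)).map_sub, rot_rot, rot_rot, add_comm]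
  rw [dist_comm, dist_eq_norm, hrot]
  refine (norm_semigroupFun_sub_le h ht v v _ (by fun_prop) x
    (ε / (C + 1)) fun ψ => ?_).trans_lt ?_
  · rw [← dist_eq_norm, dist_comm]
    exact (hs _).le
  · rw [← hC, mul_div_assoc', div_lt_iff₀ (by positivity)]
    nlinarith

/-- The Ornstein-Uhlenbeck semigroup `(T(t))_{t ≥ 0}` on `C_rub(ℝ^d, ℂ^N)`. -/
noncomputable def semigroup (h : Assumptions A B Y S) (t : ℝ) : Crub S (CSpace N) →L[ℂ] Crub S (CSpace N) :=
  if ht : 0 < t then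
    LinearMap.mkContinuous
      { toFun := fun v =>
          ⟨BoundedContinuousFunction.ofNormedAddCommGroup (semigroupFun A B S t v.1)
            (uniformContinuous_semigroupFun h ht v.1 v.2.1).continuous _
            (norm_semigroupFun_le h ht v.1),
            uniformContinuous_semigroupFun h ht v.1 v.2.1,
            tendstoUniformly_semigroupFun h ht v.1 v.2.2⟩
        map_add' := fun u v => by
          ext1; ext1 x
          change semigroupFun A B S t (u.1 + v.1) x
            = semigroupFun A B S t u.1 x + semigroupFun A B S t v.1 x
          simp only [semigroupFun, if_pos ht]
          rw [← integral_add (integrable_heatKernel h ht u.1 x) (integrable_heatKernel h ht v.1 x)]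
          simp
        map_smul' := fun c v => by
          ext1; ext1 x
          change semigroupFun A B S t (c • v.1) x = c • semigroupFun A B S t v.1 x
          simp only [semigroupFun, if_pos ht]
          rw [← integral_smul]
          simp }
      (∫ ψ : RSpace d, ‖act (kernelK A B ψ t)‖)
      (fun v => (BoundedContinuousFunction.norm_le
        (mul_nonneg (integral_nonneg fun _ => norm_nonneg _) (norm_nonneg _))).2
        (norm_semigroupFun_le h ht v.1))
  else ContinuousLinearMap.id ℂ (Crub S (CSpace N))

/-- `T(t)v` is the function given by the heat kernel formula. -/
theorem semigroup_apply (h : Assumptions A B Y S) (t : ℝ) (v : Crub S (CSpace N)) (x : RSpace d) :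
    (semigroup h t v).1 x = semigroupFun A B S t v.1 x := by
  unfold semigroup
  split_ifs with ht
  · rfl
  · simp [semigroupFun, ht]

end Semigroup

section Generator

/-- The infinitesimal generator of a one-parameter family `(T(t))_{t ≥ 0}` of bounded operators:
its domain consists of all `v` for which `(T(t)v - v)/t` converges in norm as `t ↓ 0`,
and its value at such a `v` is the limit. -/
noncomputable def generator {X : Type*} [NormedAddCommGroup X] [NormedSpace ℂ X]
    (T : ℝ → X →L[ℂ] X) : X →ₗ.[ℂ] X where
  domain :=
    { carrier := {v | ∃ w, Tendsto (fun t : ℝ => (t : ℂ)⁻¹ • (T t v - v)) (𝓝[>] 0) (𝓝 w)}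
      add_mem' := by
        rintro u v ⟨w, hw⟩ ⟨z, hz⟩
        refine ⟨w + z, (hw.add hz).congr fun t => ?_⟩
        rw [map_add, ← smul_add]
        congr 1
        abel
      zero_mem' := ⟨0, by simp⟩
      smul_mem' := by
        rintro c v ⟨w, hw⟩
        refine ⟨c • w, (hw.const_smul c).congr fun t => ?_⟩
        rw [map_smul, smul_comm, smul_sub] }
  toFun :=
    { toFun := fun v => v.2.choose
      map_add' := fun u v => by
        refine tendsto_nhds_unique (u + v).2.choose_spec
          ((u.2.choose_spec.add v.2.choose_spec).congr fun t => ?_)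
        rw [Submodule.coe_add, map_add, ← smul_add]
        congr 1
        abel
      map_smul' := fun c v => by
        refine tendsto_nhds_unique (c • v).2.choose_spec
          ((v.2.choose_spec.const_smul c).congr fun t => ?_)
        rw [Submodule.coe_smul, map_smul, smul_comm, smul_sub] }

/-- The value of the generator is the limit of the difference quotients. -/
theorem generator_tendsto {X : Type*} [NormedAddCommGroup X] [NormedSpace ℂ X]
    (T : ℝ → X →L[ℂ] X) (v : (generator T).domain) :
    Tendsto (fun t : ℝ => (t : ℂ)⁻¹ • (T t (v : X) - (v : X))) (𝓝[>] 0) (𝓝 (generator T v)) :=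
  v.2.choose_spec

/-- The generator `A_b` of the Ornstein-Uhlenbeck semigroup on `C_rub(ℝ^d, ℂ^N)`. -/
noncomputable def Ab {d N : ℕ} {A B Y : CMat N} {S : RMat d} (h : Assumptions A B Y S) :
    Crub S (CSpace N) →ₗ.[ℂ] Crub S (CSpace N) :=
  generator (X := Crub S (CSpace N)) (semigroup h)

end Generator

end OrnsteinUhlenbeck

/-! The theorem is the Laplace transform description of the resolvent of a strongly continuous
semigroup, applied once $T(t)$ is known to be one of type $\|T(t)\|\le M_b e^{\omega_b t}$ on
$C_{rub}$.

Abstractly, put $R=\int_0^\infty e^{-\lambda t}T(t)g\,dt$. Shifting time gives $T(h)R=e^{\lambda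
h}\bigl(R-\int_0^h e^{-\lambda t}T(t)g\,dt\bigr)$, whose right derivative at $h=0$ is $\lambda R-g$,
so $R$ solves the equation (`tendsto_integral_exp_smul`). If $A_bv=\lambda v$, then $e^{-\lambda
t}T(t)v$ is constant and decays, so $v=0$ (`eq_zero_of_tendsto`). The resolvent estimate is the
integrated growth bound.

Concretely, $Y$ diagonalizes the kernel into scalar complex Gaussians. Their moduli have Gaussian
majorants of mass $a_1^{d/2}e^{-b_0t}$, and conjugation by $Y$ costs $\kappa$
(`integral_norm_act_kernelK_le`). The semigroup law is the Chapman–Kolmogorov identity together with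
rotation invariance of the kernel (`semigroupFun_semigroupFun`). Strong continuity at $0$ combines
concentration of the kernel, convergence of its total mass to the identity, and the rotation
condition that defines $C_{rub}$ (`tendsto_semigroup`). -/

namespace OrnsteinUhlenbeck

/-! ### Resolvents of strongly continuous semigroups -/

section AbstractSemigroup

variable {X : Type*} [NormedAddCommGroup X] [NormedSpace ℂ X]

/-- A strongly continuous semigroup of bounded operators of growth type `(M, ω)`. -/
structure IsStronglyContinuousSemigroup (T : ℝ → X →L[ℂ] X) (M ω : ℝ) : Prop where
  zero : T 0 = ContinuousLinearMap.id ℂ X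
  add : ∀ s t, 0 < s → 0 < t → ∀ v, T (s + t) v = T s (T t v)
  norm_le : ∀ t, 0 < t → ‖T t‖ ≤ M * Real.exp (ω * t)
  tendsto : ∀ v, Tendsto (fun t => T t v) (𝓝[>] 0) (𝓝 v)

namespace IsStronglyContinuousSemigroup

variable {T : ℝ → X →L[ℂ] X} {M ω : ℝ}

theorem add_apply (hT : IsStronglyContinuousSemigroup T M ω) {s t : ℝ} (hs : 0 ≤ s) (ht : 0 ≤ t)
    (v : X) : T (s + t) v = T s (T t v) := by
  rcases hs.eq_or_lt with rfl | hs
  · simp [hT.zero]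
  rcases ht.eq_or_lt with rfl | ht
  · simp [hT.zero]
  exact hT.add s t hs ht v

theorem bound_nonneg (hT : IsStronglyContinuousSemigroup T M ω) : 0 ≤ M :=
  nonneg_of_mul_nonneg_left ((norm_nonneg _).trans (hT.norm_le 1 one_pos)) (Real.exp_pos _)

theorem tendsto_zero (hT : IsStronglyContinuousSemigroup T M ω) (v : X) :
    Tendsto (fun t => T t v) (𝓝[≥] 0) (𝓝 v) := by
  rw [← Ioi_insert, nhdsWithin_insert, tendsto_sup]
  refine ⟨?_, hT.tendsto v⟩
  have h0 := tendsto_pure_nhds (fun t => T t v) (0 : ℝ)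
  simpa [hT.zero] using h0

/-- The growth bound is assumed only for positive times: `M + 1` also covers the identity at $t=0$,
and `|ω|` makes the bound monotone in $t$, hence locally uniform. -/
theorem norm_le_of_nonneg (hT : IsStronglyContinuousSemigroup T M ω) {t : ℝ} (ht : 0 ≤ t) :
    ‖T t‖ ≤ (M + 1) * Real.exp (|ω| * t) := by
  have hM := hT.bound_nonneg
  rcases ht.eq_or_lt with rfl | ht
  · rw [hT.zero, mul_zero, Real.exp_zero, mul_one]
    exact ContinuousLinearMap.norm_id_le.trans (by linarith)
  · refine (hT.norm_le t ht).trans ?_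
    gcongr
    · linarith
    · exact le_abs_self ω

theorem norm_sub_le_of_le (hT : IsStronglyContinuousSemigroup T M ω) {s t : ℝ} (hs : 0 ≤ s)
    (hst : s ≤ t) (v : X) :
    ‖T t v - T s v‖ ≤ (M + 1) * Real.exp (|ω| * s) * ‖T (t - s) v - v‖ := by
  have h1 : T t v = T s (T (t - s) v) := by
    rw [← hT.add_apply hs (sub_nonneg.2 hst), add_sub_cancel]
  rw [h1, ← map_sub]
  exact (T s).le_of_opNorm_le (hT.norm_le_of_nonneg hs) _

/-- Factoring out the smaller of the times $s,t$ reduces both one-sided limits to right continuity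
at $0$, evaluated at $|s-t|$. -/
theorem continuousOn (hT : IsStronglyContinuousSemigroup T M ω) (v : X) :
    ContinuousOn (fun t => T t v) (Ici 0) := by
  have hM := hT.bound_nonneg
  intro t ht
  have ht' : (0 : ℝ) ≤ t := ht
  rw [ContinuousWithinAt, tendsto_iff_norm_sub_tendsto_zero]
  have habs : Tendsto (fun s : ℝ => |s - t|) (𝓝[Ici 0] t) (𝓝[≥] 0) := by
    refine tendsto_nhdsWithin_of_tendsto_nhds_of_eventually_within _ ?_
      (Eventually.of_forall fun s => mem_Ici.2 (abs_nonneg _))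
    have : Continuous fun s : ℝ => |s - t| := by fun_prop
    simpa using (this.tendsto t).mono_left nhdsWithin_le_nhds
  have hlim := (tendsto_iff_norm_sub_tendsto_zero.1 ((hT.tendsto_zero v).comp habs)).const_mul
    ((M + 1) * Real.exp (|ω| * t))
  rw [mul_zero] at hlim
  refine squeeze_zero' (Eventually.of_forall fun _ => norm_nonneg _) ?_ hlim
  filter_upwards [self_mem_nhdsWithin] with s hs
  have hs' : (0 : ℝ) ≤ s := hs
  rcases le_total s t with hst | hst
  · rw [norm_sub_rev, Function.comp_apply, abs_sub_comm, abs_of_nonneg (sub_nonneg.2 hst)]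
    refine (hT.norm_sub_le_of_le hs' hst v).trans ?_
    gcongr
  · rw [Function.comp_apply, abs_of_nonneg (sub_nonneg.2 hst)]
    exact hT.norm_sub_le_of_le ht' hst v

theorem continuousOn_exp_smul (hT : IsStronglyContinuousSemigroup T M ω) (lam : ℂ) (v : X) :
    ContinuousOn (fun t : ℝ => Complex.exp (-lam * t) • T t v) (Ici 0) :=
  (by fun_prop : Continuous fun t : ℝ => Complex.exp (-lam * t)).continuousOn.smul
    (hT.continuousOn v)

theorem norm_exp_smul_le (hT : IsStronglyContinuousSemigroup T M ω) (lam : ℂ) (v : X) {t : ℝ}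
    (ht : 0 < t) :
    ‖Complex.exp (-lam * t) • T t v‖ ≤ M * ‖v‖ * Real.exp (-(lam.re - ω) * t) := by
  have h1 : ‖Complex.exp (-lam * t)‖ = Real.exp (-lam.re * t) := by
    rw [Complex.norm_exp]; simp
  rw [norm_smul, h1]
  refine (mul_le_mul_of_nonneg_left ((T t).le_of_opNorm_le (hT.norm_le t ht) v)
    (Real.exp_pos _).le).trans_eq ?_
  have h2 : Real.exp (-(lam.re - ω) * t) = Real.exp (-lam.re * t) * Real.exp (ω * t) := by
    rw [← Real.exp_add]; ring_nf
  rw [h2]; ring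

theorem integrableOn_exp_smul (hT : IsStronglyContinuousSemigroup T M ω) {lam : ℂ}
    (hlam : ω < lam.re) (v : X) :
    IntegrableOn (fun t : ℝ => Complex.exp (-lam * t) • T t v) (Ioi 0) := by
  refine ((exp_neg_integrableOn_Ioi 0 (sub_pos.2 hlam)).const_mul (M * ‖v‖)).mono'
    (((hT.continuousOn_exp_smul lam v).mono Ioi_subset_Ici_self).aestronglyMeasurable
      measurableSet_Ioi) ?_
  filter_upwards [ae_restrict_mem measurableSet_Ioi] with t ht
  exact hT.norm_exp_smul_le lam v ht

theorem norm_integral_exp_smul_le (hT : IsStronglyContinuousSemigroup T M ω) {lam : ℂ}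
    (hlam : ω < lam.re) (v : X) :
    ‖∫ t in Ioi (0 : ℝ), Complex.exp (-lam * t) • T t v‖ ≤ M / (lam.re - ω) * ‖v‖ := by
  have hpos := sub_pos.2 hlam
  refine (norm_integral_le_of_norm_le
    ((exp_neg_integrableOn_Ioi 0 hpos).const_mul (M * ‖v‖)) ?_).trans_eq ?_
  · filter_upwards [ae_restrict_mem measurableSet_Ioi] with t ht
    exact hT.norm_exp_smul_le lam v ht
  · rw [integral_const_mul, integral_exp_mul_Ioi (neg_lt_zero.2 hpos)]
    simp only [mul_zero, Real.exp_zero]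
    field_simp

/-- Applying $T(h)$ shifts the orbit by $h$; the substitution $t\mapsto t+h$ leaves the tail
integral over $(h,\infty)$ times $e^{\lambda h}$. -/
theorem apply_integral_exp_smul [CompleteSpace X] (hT : IsStronglyContinuousSemigroup T M ω)
    {lam : ℂ} (hlam : ω < lam.re) (v : X) {h : ℝ} (hh : 0 ≤ h) :
    T h (∫ t in Ioi (0 : ℝ), Complex.exp (-lam * t) • T t v)
      = Complex.exp (lam * h) • ((∫ t in Ioi (0 : ℝ), Complex.exp (-lam * t) • T t v)
        - ∫ t in (0 : ℝ)..h, Complex.exp (-lam * t) • T t v) := by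
  have hint := hT.integrableOn_exp_smul hlam v
  have hsub := intervalIntegral.integral_interval_add_Ioi hint (hint.mono_set (Ioi_subset_Ioi hh))
  rw [sub_eq_of_eq_add' hsub.symm, ← (T h).integral_comp_comm hint, ← integral_smul]
  have hshift := (measurePreserving_add_right volume h).setIntegral_preimage_emb
    (measurableEmbedding_addRight h)
    (fun t : ℝ => Complex.exp (lam * h) • Complex.exp (-lam * t) • T t v) (Ioi h)
  rw [preimage_add_const_Ioi, sub_self] at hshift
  rw [← hshift]
  refine setIntegral_congr_fun measurableSet_Ioi fun t ht => ?_
  have ht' : (0 : ℝ) < t := ht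
  rw [map_smul, ← hT.add_apply hh ht'.le, add_comm h t, smul_smul, ← Complex.exp_add]
  congr 2
  push_cast
  ring

theorem tendsto_integral_exp_smul [CompleteSpace X] (hT : IsStronglyContinuousSemigroup T M ω)
    {lam : ℂ} (hlam : ω < lam.re) (v : X) :
    Tendsto (fun h : ℝ => (h : ℂ)⁻¹ • (T h (∫ t in Ioi (0 : ℝ), Complex.exp (-lam * t) • T t v)
        - ∫ t in Ioi (0 : ℝ), Complex.exp (-lam * t) • T t v)) (𝓝[>] 0)
      (𝓝 (lam • (∫ t in Ioi (0 : ℝ), Complex.exp (-lam * t) • T t v) - v)) := by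
  set R := ∫ t in Ioi (0 : ℝ), Complex.exp (-lam * t) • T t v with hR
  set f := fun t : ℝ => Complex.exp (-lam * t) • T t v with hf
  have hcont := hT.continuousOn_exp_smul lam v
  have hF : HasDerivWithinAt (fun h : ℝ => ∫ t in (0 : ℝ)..h, f t) (f 0) (Ici 0) 0 := by
    refine intervalIntegral.integral_hasDerivWithinAt_right (by simp) (t := Ioi 0) ?_
      ((hcont 0 self_mem_Ici).mono Ioi_subset_Ici_self)
    exact ⟨Ioi 0, self_mem_nhdsWithin, (hcont.mono Ioi_subset_Ici_self).aestronglyMeasurable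
      measurableSet_Ioi⟩
  have hE : HasDerivWithinAt (fun h : ℝ => Complex.exp (lam * h)) lam (Ici 0) 0 := by
    have h1 : HasDerivAt (fun z : ℂ => Complex.exp (lam * z)) (Complex.exp (lam * 0) * (lam * 1))
      ((0 : ℝ) : ℂ) := by
      simpa using ((hasDerivAt_id ((0 : ℝ) : ℂ)).const_mul lam).cexp
    simpa using h1.comp_ofReal.hasDerivWithinAt
  -- Product rule at $h=0$ for $e^{\lambda h}\cdot(R-\int_0^h f)$: the two terms give $-v$ and
  -- $\lambda R$.
  have hD := hE.smul (hF.const_sub R)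
  have hD' : HasDerivWithinAt (fun h : ℝ => T h R) (lam • R - v) (Ici 0) 0 := by
    refine (hD.congr_of_mem (fun h hh => ?_) self_mem_Ici).congr_deriv ?_
    · exact hT.apply_integral_exp_smul hlam v hh
    · simp [hf, hT.zero]; abel
  have hs := (hasDerivWithinAt_iff_tendsto_slope' self_notMem_Ioi).1 hD'.Ioi_of_Ici
  refine hs.congr fun h => ?_
  rw [slope_def_module, sub_zero, hT.zero, ContinuousLinearMap.id_apply, ← Complex.ofReal_inv,
    Complex.coe_smul]

/-- The rescaled orbit $e^{-\lambda t}T(t)v$ has right derivative zero everywhere, so it stays equal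
to $v$, while the growth bound forces it to $0$ as $t\to\infty$. -/
theorem eq_zero_of_tendsto (hT : IsStronglyContinuousSemigroup T M ω) {lam : ℂ}
    (hlam : ω < lam.re) {v : X}
    (hv : Tendsto (fun h : ℝ => (h : ℂ)⁻¹ • (T h v - v)) (𝓝[>] 0) (𝓝 (lam • v))) : v = 0 := by
  have h0 : HasDerivWithinAt (fun h : ℝ => T h v) (lam • v) (Ici 0) 0 := by
    rw [← hasDerivWithinAt_Ioi_iff_Ici, hasDerivWithinAt_iff_tendsto_slope' self_notMem_Ioi]
    refine hv.congr fun h => ?_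
    rw [slope_def_module, sub_zero, hT.zero, ContinuousLinearMap.id_apply, ← Complex.ofReal_inv,
      Complex.coe_smul]
  have hderiv : ∀ t : ℝ, 0 ≤ t →
      HasDerivWithinAt (fun s : ℝ => Complex.exp (-lam * s) • T s v) 0 (Ici t) t := by
    intro t ht
    have h1 : HasDerivWithinAt (fun s : ℝ => T s v) (T t (lam • v)) (Ici t) t := by
      have h2 : HasDerivWithinAt (fun s : ℝ => s - t) 1 (Ici t) t :=
        ((hasDerivAt_id t).sub_const t).hasDerivWithinAt
      -- The semigroup law transports the derivative at $0$ to time $t$ through $s\mapsto s-t$;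
      -- writing the base point as `t - t` fits the chain rule.
      have h0' : HasDerivWithinAt (fun h : ℝ => T h v) (lam • v) (Ici 0) (t - t) := by
        rwa [sub_self]
      have h3 := HasDerivWithinAt.scomp (h := fun s => s - t) t h0' h2
        (fun s hs => sub_nonneg.2 (mem_Ici.1 hs))
      have h4 := ((T t).restrictScalars ℝ).hasFDerivAt.comp_hasDerivWithinAt t h3
      refine (h4.congr_of_mem (fun s hs => ?_) self_mem_Ici).congr_deriv (by simp)
      change T s v = T t (T (s - t) v)
      rw [← hT.add_apply ht (sub_nonneg.2 (mem_Ici.1 hs)), add_sub_cancel]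
    have hE : HasDerivWithinAt (fun s : ℝ => Complex.exp (-lam * s))
        (Complex.exp (-lam * t) * -lam) (Ici t) t := by
      have h1 : HasDerivAt (fun z : ℂ => Complex.exp (-lam * z))
        (Complex.exp (-lam * t) * -lam) (t : ℂ) := by
        simpa using ((hasDerivAt_id (t : ℂ)).const_mul (-lam)).cexp
      exact h1.comp_ofReal.hasDerivWithinAt
    refine (hE.smul h1).congr_deriv ?_
    rw [map_smul, smul_smul, ← add_smul]
    simp
  have hconst : ∀ t : ℝ, 0 < t → Complex.exp (-lam * t) • T t v = v := by
    intro t ht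
    have := constant_of_has_deriv_right_zero (a := 0) (b := t)
      ((hT.continuousOn_exp_smul lam v).mono Icc_subset_Ici_self) (fun s hs => hderiv s hs.1) t
      ⟨ht.le, le_rfl⟩
    simpa [hT.zero] using this
  have hlim : Tendsto (fun t : ℝ => M * ‖v‖ * Real.exp (-(lam.re - ω) * t)) atTop (𝓝 0) := by
    have h1 : Tendsto (fun t : ℝ => -(lam.re - ω) * t) atTop atBot :=
      tendsto_id.const_mul_atTop_of_neg (by linarith)
    simpa using (Real.tendsto_exp_atBot.comp h1).const_mul (M * ‖v‖)
  have hle : ‖v‖ ≤ 0 := by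
    refine ge_of_tendsto hlim ?_
    filter_upwards [eventually_gt_atTop 0] with t ht
    exact (congrArg norm (hconst t ht)).symm.trans_le (hT.norm_exp_smul_le lam v ht)
  exact norm_le_zero_iff.1 hle

end IsStronglyContinuousSemigroup

/-- The generator picks its value by choice; uniqueness of limits identifies that value with any
limit computed by hand. -/
theorem generator_mem_and_eq {T : ℝ → X →L[ℂ] X} {v w : X}
    (hvw : Tendsto (fun t : ℝ => (t : ℂ)⁻¹ • (T t v - v)) (𝓝[>] 0) (𝓝 w)) :
    ∃ hv : v ∈ (generator T).domain, generator T ⟨v, hv⟩ = w :=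
  ⟨⟨w, hvw⟩, tendsto_nhds_unique (generator_tendsto T ⟨v, ⟨w, hvw⟩⟩) hvw⟩

end AbstractSemigroup

/-! ### Scalar complex Gaussians: mass, convolution and majorants -/

section HeatFactor

/-- The scalar heat kernel `(4πta)^{-d/2} exp(-bt - |ψ|²/(4ta))`, an eigenvalue of `kernelK`. -/
noncomputable def heatFactor {d : ℕ} (a b : ℂ) (t : ℝ) (ψ : RSpace d) : ℂ :=
  (4 * Real.pi * t * a) ^ (-(d : ℂ) / 2) *
    Complex.exp (-(t * b) - (‖ψ‖ ^ 2 : ℝ) * (4 * t * a)⁻¹)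

variable {d : ℕ} {a b : ℂ}

/-- A positive real factor does not change the argument, so the principal logarithm splits. Powers
of different real multiples of $a$ can then be combined without branch corrections. -/
theorem ofReal_mul_cpow_eq_exp {r : ℝ} (hr : 0 < r) (ha : a ≠ 0) (w : ℂ) :
    ((r : ℂ) * a) ^ w = Complex.exp ((Real.log r + Complex.log a) * w) := by
  rw [Complex.cpow_def_of_ne_zero (mul_ne_zero (by exact_mod_cast hr.ne') ha),
    Complex.log_ofReal_mul hr ha]

theorem re_inv_four_mul {t : ℝ} (ht : 0 < t) :
    ((4 * t * a : ℂ)⁻¹).re = a.re / (4 * t * ‖a‖ ^ 2) := by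
  have h1 : (4 * t * a : ℂ)⁻¹ = (((4 * t)⁻¹ : ℝ) : ℂ) * a⁻¹ := by
    push_cast; rw [mul_inv]
  rw [h1, Complex.re_ofReal_mul, Complex.inv_re, Complex.normSq_eq_norm_sq]
  field_simp

theorem re_inv_four_mul_pos {t : ℝ} (ht : 0 < t) (ha : 0 < a.re) : 0 < ((4 * t * a : ℂ)⁻¹).re := by
  have ha0 : a ≠ 0 := by rintro rfl; simp at ha
  rw [re_inv_four_mul ht]
  positivity

theorem integrable_heatFactor {t : ℝ} (ht : 0 < t) (ha : 0 < a.re) :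
    Integrable (heatFactor (d := d) a b t) :=
  integrable_gaussian d (re_inv_four_mul_pos ht ha) _ _

theorem integral_heatFactor {t : ℝ} (ht : 0 < t) (ha : 0 < a.re) :
    ∫ ψ : RSpace d, heatFactor a b t ψ = Complex.exp (-(t * b)) := by
  have ha0 : a ≠ 0 := by rintro rfl; simp at ha
  have ht0 : (t : ℂ) ≠ 0 := by exact_mod_cast ht.ne'
  have h1 : ∀ ψ : RSpace d, heatFactor a b t ψ = (4 * Real.pi * t * a) ^ (-(d : ℂ) / 2) *
      Complex.exp (-(t * b)) * Complex.exp (-(4 * t * a : ℂ)⁻¹ * ‖ψ‖ ^ 2) := by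
    intro ψ
    conv_rhs => rw [mul_assoc, ← Complex.exp_add]
    rw [heatFactor]
    congr 2
    push_cast
    ring
  simp_rw [h1]
  rw [integral_const_mul, GaussianFourier.integral_cexp_neg_mul_sq_norm (re_inv_four_mul_pos ht ha),
    finrank_euclideanSpace_fin]
  have h2 : (Real.pi : ℂ) / (4 * t * a)⁻¹ = 4 * Real.pi * t * a := by
    rw [div_inv_eq_mul]; ring
  have h3 : (4 * Real.pi * t * a : ℂ) ≠ 0 := by
    have : (Real.pi : ℂ) ≠ 0 := by exact_mod_cast Real.pi_ne_zero
    simp [this, ht0, ha0]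
  rw [h2, mul_right_comm, ← Complex.cpow_add _ _ h3]
  rw [neg_div, neg_add_cancel, Complex.cpow_zero, one_mul]

theorem heatFactor_mul_heatFactor {s t : ℝ} (φ ψ : RSpace d) :
    heatFactor a b s ψ * heatFactor a b t (φ - ψ)
      = (4 * Real.pi * s * a) ^ (-(d : ℂ) / 2) * (4 * Real.pi * t * a) ^ (-(d : ℂ) / 2) *
        Complex.exp (-((s + t) * b) - (‖φ‖ ^ 2 : ℝ) * (4 * t * a)⁻¹) *
        Complex.exp (-((4 * s * a : ℂ)⁻¹ + (4 * t * a)⁻¹) * ‖ψ‖ ^ 2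
          + 2 * (4 * t * a)⁻¹ * (inner ℝ φ ψ : ℝ)) := by
  conv_rhs => rw [mul_assoc, ← Complex.exp_add]
  rw [heatFactor, heatFactor, mul_mul_mul_comm, ← Complex.exp_add, norm_sub_sq_real]
  congr 2
  push_cast
  ring

theorem integrable_heatFactor_mul {s t : ℝ} (hs : 0 < s) (ht : 0 < t) (ha : 0 < a.re)
    (φ : RSpace d) :
    Integrable fun ψ : RSpace d => heatFactor a b s ψ * heatFactor a b t (φ - ψ) := by
  simp_rw [heatFactor_mul_heatFactor]
  exact (GaussianFourier.integrable_cexp_neg_mul_sq_norm_add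
    (add_pos (re_inv_four_mul_pos hs ha) (re_inv_four_mul_pos ht ha)) _ _).const_mul _

/-- Chapman–Kolmogorov for one eigenvalue pair: the integrand is a Gaussian with a linear term, and
its integral has base $4\pi\frac{st}{s+t}a$. With all powers written as exponentials, only an
identity between exponents remains. -/
theorem integral_heatFactor_mul {s t : ℝ} (hs : 0 < s) (ht : 0 < t) (ha : 0 < a.re)
    (φ : RSpace d) :
    ∫ ψ : RSpace d, heatFactor a b s ψ * heatFactor a b t (φ - ψ) = heatFactor a b (s + t) φ := by
  have ha0 : a ≠ 0 := by rintro rfl; simp at ha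
  have hs0 : (s : ℂ) ≠ 0 := by exact_mod_cast hs.ne'
  have ht0 : (t : ℂ) ≠ 0 := by exact_mod_cast ht.ne'
  have hst0 : (s + t : ℂ) ≠ 0 := by exact_mod_cast (add_pos hs ht).ne'
  have hβ : 0 < ((4 * s * a : ℂ)⁻¹ + (4 * t * a)⁻¹).re :=
    add_pos (re_inv_four_mul_pos hs ha) (re_inv_four_mul_pos ht ha)
  simp_rw [heatFactor_mul_heatFactor]
  rw [integral_const_mul, GaussianFourier.integral_cexp_neg_mul_sq_norm_add hβ,
    finrank_euclideanSpace_fin]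
  have h2 : (Real.pi : ℂ) / ((4 * s * a : ℂ)⁻¹ + (4 * t * a)⁻¹)
      = ((4 * Real.pi * (s * t / (s + t)) : ℝ) : ℂ) * a := by
    push_cast
    have : (4 * s * a : ℂ)⁻¹ + (4 * t * a)⁻¹ = (s + t) / (4 * s * t * a) := by
      field_simp
      ring
    rw [this]
    field_simp
  have h3 : ∀ r : ℝ, (4 * Real.pi * r * a : ℂ) = ((4 * Real.pi * r : ℝ) : ℂ) * a := by
    intro r; push_cast; ring
  have hpi := Real.pi_pos
  rw [heatFactor, h2, h3, h3, h3, ofReal_mul_cpow_eq_exp (by positivity) ha0,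
    ofReal_mul_cpow_eq_exp (by positivity) ha0, ofReal_mul_cpow_eq_exp (by positivity) ha0,
    ofReal_mul_cpow_eq_exp (by positivity) ha0, ← Complex.exp_add, ← Complex.exp_add,
    ← Complex.exp_add, ← Complex.exp_add, ← Complex.exp_add]
  have hst := (add_pos hs ht).ne'
  have hlog : ∀ r : ℝ, 0 < r → Real.log (4 * Real.pi * r) = Real.log (4 * Real.pi) + Real.log r :=
    fun r hr => Real.log_mul (by positivity) hr.ne'
  rw [hlog s hs, hlog t ht, hlog (s + t) (add_pos hs ht), hlog (s * t / (s + t)) (by positivity),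
    Real.log_div (by positivity) hst, Real.log_mul hs.ne' ht.ne']
  congr 1
  -- The term from completing the square, simplified by $\frac{s}{t(s+t)}=\frac1t-\frac1{s+t}$.
  have h4 : (2 * (4 * t * a : ℂ)⁻¹) ^ 2 * ‖φ‖ ^ 2 / (4 * ((4 * s * a : ℂ)⁻¹ + (4 * t * a)⁻¹))
      = ‖φ‖ ^ 2 * (4 * t * a)⁻¹ - ‖φ‖ ^ 2 * (4 * (s + t) * a)⁻¹ := by
    have : (4 * s * a : ℂ)⁻¹ + (4 * t * a)⁻¹ = (s + t) / (4 * s * t * a) := by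
      field_simp
      ring
    rw [this]
    field_simp
    ring
  rw [h4]
  push_cast
  ring

theorem norm_heatFactor {t : ℝ} (ht : 0 < t) (ψ : RSpace d) :
    ‖heatFactor a b t ψ‖ = (4 * Real.pi * t * ‖a‖) ^ (-(d : ℝ) / 2) *
      (Real.exp (-(t * b.re)) * Real.exp (-(a.re / (4 * t * ‖a‖ ^ 2)) * ‖ψ‖ ^ 2)) := by
  have h1 : (-(d : ℂ) / 2) = ((-(d : ℝ) / 2 : ℝ) : ℂ) := by push_cast; ring
  rw [heatFactor, norm_mul, h1, Complex.norm_cpow_real, Complex.norm_exp, ← Real.exp_add]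
  congr 2
  · have hpi := Real.pi_pos
    simp [abs_of_pos, ht, hpi]
  · rw [Complex.sub_re, Complex.re_ofReal_mul, re_inv_four_mul ht, Complex.neg_re,
      Complex.re_ofReal_mul]
    ring

/-- A Gaussian majorant of the scalar heat kernel. -/
noncomputable def gaussianBound {d : ℕ} (α ε R β t : ℝ) (ψ : RSpace d) : ℝ :=
  (4 * Real.pi * t * α) ^ (-(d : ℝ) / 2) *
    (Real.exp (-(t * β)) * Real.exp (-(ε / (4 * t * R ^ 2)) * ‖ψ‖ ^ 2))

variable {α ε R β : ℝ}

/-- The prefactor decreases in $|a|$, so it needs the lower bound `α`; the decay rate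
$\operatorname{Re}a/|a|^2$ needs `ε` below and `R` above. Hence the shape $a_{\max}^2/(a_{\min}a_0)$
of $a_1$. -/
theorem norm_heatFactor_le (hα : 0 < α) (hε : 0 < ε) (hαa : α ≤ ‖a‖) (hεa : ε ≤ a.re)
    (haR : ‖a‖ ≤ R) (hβ : β ≤ b.re) {t : ℝ} (ht : 0 < t) (ψ : RSpace d) :
    ‖heatFactor a b t ψ‖ ≤ gaussianBound α ε R β t ψ := by
  have hpi := Real.pi_pos
  have ha : 0 < ‖a‖ := hα.trans_le hαa
  have hre : 0 ≤ a.re := hε.le.trans hεa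
  rw [norm_heatFactor ht, gaussianBound]
  gcongr ?_ * (Real.exp (-(t * ?_)) * Real.exp (-?_ * _))
  · refine Real.rpow_le_rpow_of_nonpos (by positivity) (by gcongr) ?_
    have : (0 : ℝ) ≤ d := d.cast_nonneg
    linarith
  · gcongr

theorem integrable_rexp_neg_mul_sq_norm (d : ℕ) {c : ℝ} (hc : 0 < c) :
    Integrable fun ψ : RSpace d => Real.exp (-c * ‖ψ‖ ^ 2) := by
  have h1 := (integrable_gaussian d (z := c) (by simpa using hc) 1 0).norm
  refine h1.congr (Eventually.of_forall fun ψ => ?_)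
  simp only [one_mul, Complex.norm_exp]
  congr 1
  rw [Complex.sub_re, Complex.re_ofReal_mul, Complex.ofReal_re, Complex.zero_re]
  ring

theorem integrable_gaussianBound (hε : 0 < ε) (hR : 0 < R) {t : ℝ} (ht : 0 < t) :
    Integrable (gaussianBound (d := d) α ε R β t) :=
  ((integrable_rexp_neg_mul_sq_norm d (by positivity)).const_mul _).const_mul _

theorem integral_gaussianBound (hα : 0 < α) (hε : 0 < ε) (hR : 0 < R) {t : ℝ} (ht : 0 < t) :
    ∫ ψ : RSpace d, gaussianBound α ε R β t ψ
      = (R ^ 2 / (α * ε)) ^ ((d : ℝ) / 2) * Real.exp (-β * t) := by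
  have hpi := Real.pi_pos
  unfold gaussianBound
  rw [integral_const_mul, integral_const_mul,
    GaussianFourier.integral_rexp_neg_mul_sq_norm (by positivity), finrank_euclideanSpace_fin,
    neg_div, Real.rpow_neg (by positivity), mul_left_comm, ← div_eq_inv_mul,
    ← Real.div_rpow (by positivity) (by positivity), mul_comm]
  congr 2
  · field_simp
  · ring

end HeatFactor

/-! ### Norms and spectral constants of conjugated diagonal matrices -/

section MatrixNorms

variable {N : ℕ} {Y : CMat N}

theorem norm_act_diagonal_le {w : Fin N → ℂ} {C : ℝ} (hC : 0 ≤ C) (hw : ∀ i, ‖w i‖ ≤ C) :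
    ‖act (Matrix.diagonal w)‖ ≤ C := by
  open scoped Matrix.Norms.L2Operator in
  exact (Matrix.l2_opNorm_toEuclideanCLM _).trans_le
    ((Matrix.l2_opNorm_diagonal w).trans_le ((pi_norm_le_iff_of_nonneg hC).2 hw))

theorem norm_act_conj_diagonal_le (Y : CMat N) {w : Fin N → ℂ} {C : ℝ} (hC : 0 ≤ C)
    (hw : ∀ i, ‖w i‖ ≤ C) :
    ‖act (Y * Matrix.diagonal w * Y⁻¹)‖ ≤ condNumber Y * C := by
  have h1 : act (Y * Matrix.diagonal w * Y⁻¹)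
      = act Y * act (Matrix.diagonal w) * act Y⁻¹ := by
    unfold act
    rw [map_mul, map_mul]
  rw [h1]
  refine (norm_mul_le _ _).trans ?_
  refine (mul_le_mul_of_nonneg_right ((norm_mul_le _ _).trans (mul_le_mul_of_nonneg_left
    (norm_act_diagonal_le hC hw) (norm_nonneg _))) (norm_nonneg _)).trans_eq ?_
  rw [condNumber, specNorm, specNorm]
  ring

theorem condNumber_nonneg (Y : CMat N) : 0 ≤ condNumber Y :=
  mul_nonneg (norm_nonneg _) (norm_nonneg _)

/-- The rank-one projections onto the columns of `Y`. -/
noncomputable def columnProj (Y : CMat N) (i : Fin N) : CSpace N →L[ℂ] CSpace N :=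
  act (Y * Matrix.single i i 1 * Y⁻¹)

theorem act_conj_diagonal (Y : CMat N) (w : Fin N → ℂ) :
    act (Y * Matrix.diagonal w * Y⁻¹) = ∑ i, w i • columnProj Y i := by
  rw [← Matrix.sum_single_eq_diagonal, Finset.mul_sum, Finset.sum_mul]
  refine (map_sum (Matrix.toEuclideanCLM (n := Fin N) (𝕜 := ℂ)) _ _).trans ?_
  refine Finset.sum_congr rfl fun i _ => ?_
  refine Eq.trans ?_ (map_smul (Matrix.toEuclideanCLM (n := Fin N) (𝕜 := ℂ)) _ _)
  rw [← smul_mul_assoc, ← mul_smul_comm, Matrix.smul_single, smul_eq_mul, mul_one]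

theorem conj_diagonal_mul (hY : IsUnit Y) (u v : Fin N → ℂ) :
    (Y * Matrix.diagonal u * Y⁻¹) * (Y * Matrix.diagonal v * Y⁻¹)
      = Y * Matrix.diagonal (fun i => u i * v i) * Y⁻¹ := by
  have hYY : Y⁻¹ * Y = 1 := Matrix.nonsing_inv_mul Y ((Matrix.isUnit_iff_isUnit_det Y).1 hY)
  calc _ = Y * Matrix.diagonal u * (Y⁻¹ * Y) * Matrix.diagonal v * Y⁻¹ := by
          simp only [mul_assoc]
    _ = Y * (Matrix.diagonal u * Matrix.diagonal v) * Y⁻¹ := by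
          rw [hYY]; simp only [mul_assoc, one_mul]
    _ = _ := by rw [Matrix.diagonal_mul_diagonal]

/-- Similarity invariance of the spectrum; it turns the spectral constants into finite suprema over
diagonal entries. -/
theorem spectrum_conj_diagonal (hY : IsUnit Y) (a : Fin N → ℂ) :
    spectrum ℂ (Y * Matrix.diagonal a * Y⁻¹) = Set.range a := by
  obtain ⟨U, rfl⟩ := hY
  rw [← Matrix.coe_units_inv, spectrum.units_conjugate, spectrum_diagonal]

theorem specRadius_conj_diagonal (hY : IsUnit Y) (a : Fin N → ℂ) :
    specRadius (Y * Matrix.diagonal a * Y⁻¹) = ⨆ i, ‖a i‖ := by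
  rw [specRadius, spectrum_conj_diagonal hY, ← Set.range_comp]
  rfl

theorem neg_specAbscissa_neg_conj_diagonal (hY : IsUnit Y) (a : Fin N → ℂ) :
    -specAbscissa (-(Y * Matrix.diagonal a * Y⁻¹)) = -⨆ i, -(a i).re := by
  have h1 : -(Y * Matrix.diagonal a * Y⁻¹) = Y * Matrix.diagonal (-a) * Y⁻¹ := by
    rw [← neg_mul, ← mul_neg, Matrix.diagonal_neg]
    rfl
  rw [h1, specAbscissa, spectrum_conj_diagonal hY, ← Set.range_comp]
  rfl

variable {a : Fin N → ℂ}

theorem norm_le_aMax (hY : IsUnit Y) (i : Fin N) :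
    ‖a i‖ ≤ aMax (Y * Matrix.diagonal a * Y⁻¹) := by
  rw [aMax, specRadius_conj_diagonal hY]
  exact le_ciSup (f := fun i => ‖a i‖) (Set.finite_range _).bddAbove i

theorem aMin_le_norm (hY : IsUnit Y) (ha : ∀ i, a i ≠ 0) (i : Fin N) :
    aMin (Y * Matrix.diagonal a * Y⁻¹) ≤ ‖a i‖ := by
  rw [aMin, inv_conj_diagonal hY a ha, specRadius_conj_diagonal hY]
  refine inv_le_of_inv_le₀ (norm_pos_iff.2 (ha i)) ?_
  rw [← norm_inv]
  exact le_ciSup (f := fun i => ‖(a i)⁻¹‖) (Set.finite_range _).bddAbove i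

theorem aMin_pos [Nonempty (Fin N)] (hY : IsUnit Y) (ha : ∀ i, a i ≠ 0) :
    0 < aMin (Y * Matrix.diagonal a * Y⁻¹) := by
  obtain ⟨i⟩ := ‹Nonempty (Fin N)›
  rw [aMin, inv_conj_diagonal hY a ha, specRadius_conj_diagonal hY]
  exact inv_pos.2 ((norm_pos_iff.2 (inv_ne_zero (ha i))).trans_le
    (le_ciSup (f := fun i => ‖(a i)⁻¹‖) (Set.finite_range _).bddAbove i))

theorem aZero_le_re (hY : IsUnit Y) (i : Fin N) :
    aZero (Y * Matrix.diagonal a * Y⁻¹) ≤ (a i).re := by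
  rw [aZero, neg_specAbscissa_neg_conj_diagonal hY, neg_le]
  exact le_ciSup (f := fun i => -(a i).re) (Set.finite_range _).bddAbove i

theorem aZero_pos [Nonempty (Fin N)] (hY : IsUnit Y) (ha : ∀ i, 0 < (a i).re) :
    0 < aZero (Y * Matrix.diagonal a * Y⁻¹) := by
  rw [aZero, neg_specAbscissa_neg_conj_diagonal hY, neg_pos]
  obtain ⟨i, hi⟩ := exists_eq_ciSup_of_finite (f := fun i => -(a i).re)
  rw [← hi]
  exact neg_neg_of_pos (ha i)

/-- `bZero` and `aZero` unfold to the same expression, so no new argument is needed. -/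
theorem bZero_le_re (hY : IsUnit Y) (i : Fin N) :
    bZero (Y * Matrix.diagonal a * Y⁻¹) ≤ (a i).re :=
  aZero_le_re hY i

end MatrixNorms

/-! ### The matrix kernel: growth bound, convolution and total mass -/

section KernelBounds

variable {d N : ℕ} {A B Y : CMat N} {S : RMat d}

theorem norm_act_kernelK_le [Nonempty (Fin N)] (h : Assumptions A B Y S) {t : ℝ} (ht : 0 < t)
    (ψ : RSpace d) :
    ‖act (kernelK A B ψ t)‖
      ≤ condNumber Y * gaussianBound (aMin A) (aZero A) (aMax A) (bZero B) t ψ := by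
  obtain ⟨a, b, hA, hB, ha⟩ := h.exists_diag
  have ha' : ∀ i, a i ≠ 0 := fun i h0 => by simpa [h0] using ha i
  have hY := h.isUnit_Y
  have hmin := aMin_pos hY ha'
  have hzero := aZero_pos hY ha
  rw [kernelK_eq hY hA hB ha' ht, hA, hB]
  have hle := fun i => norm_heatFactor_le hmin hzero (aMin_le_norm hY ha' i)
    (aZero_le_re hY i) (norm_le_aMax hY i) (bZero_le_re (a := b) hY i) ht ψ
  obtain ⟨i⟩ := ‹Nonempty (Fin N)›
  exact norm_act_conj_diagonal_le Y ((norm_nonneg _).trans (hle i)) hle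

theorem Assumptions.constants_pos [Nonempty (Fin N)] (h : Assumptions A B Y S) :
    0 < aMin A ∧ 0 < aZero A ∧ 0 < aMax A := by
  obtain ⟨a, b, hA, -, ha⟩ := h.exists_diag
  have ha' : ∀ i, a i ≠ 0 := fun i h0 => by simpa [h0] using ha i
  have hY := h.isUnit_Y
  rw [hA]
  refine ⟨aMin_pos hY ha', aZero_pos hY ha, ?_⟩
  obtain ⟨i⟩ := ‹Nonempty (Fin N)›
  exact (norm_pos_iff.2 (ha' i)).trans_le (norm_le_aMax hY i)

theorem integral_norm_act_kernelK_le (h : Assumptions A B Y S) {t : ℝ} (ht : 0 < t) :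
    ∫ ψ : RSpace d, ‖act (kernelK A B ψ t)‖ ≤ Mb d A Y * Real.exp (omegaB B * t) := by
  rcases isEmpty_or_nonempty (Fin N) with hN | hN
  -- For $N=0$ the spectra are empty and positivity of the constants fails, but every operator
  -- vanishes and both sides are $0$.
  · have h0 : ∀ C : CSpace N →L[ℂ] CSpace N, ‖C‖ = 0 := fun C => by
      rw [norm_eq_zero]; exact Subsingleton.elim _ _
    simp [Mb, condNumber, specNorm, h0]
  obtain ⟨h1, h2, h3⟩ := h.constants_pos
  refine (integral_mono (integrable_kernelK h ht).norm
    ((integrable_gaussianBound h2 h3 ht).const_mul _)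
    (norm_act_kernelK_le h ht)).trans_eq ?_
  rw [integral_const_mul, integral_gaussianBound h1 h2 h3 ht, Mb, aOne, omegaB, mul_assoc]

theorem act_kernelK_eq {a b : Fin N → ℂ} (hY : IsUnit Y) (hA : A = Y * Matrix.diagonal a * Y⁻¹)
    (hB : B = Y * Matrix.diagonal b * Y⁻¹) (ha : ∀ i, a i ≠ 0) {t : ℝ} (ht : 0 < t)
    (ψ : RSpace d) :
    act (kernelK A B ψ t) = ∑ i, heatFactor (a i) (b i) t ψ • columnProj Y i := by
  rw [kernelK_eq hY hA hB ha ht, act_conj_diagonal]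
  rfl

/-- Both kernels are diagonal in the same basis, so their product is too, and the scalar identity
applies to each eigenvalue pair. -/
theorem integral_act_kernelK_mul (h : Assumptions A B Y S) {s t : ℝ} (hs : 0 < s) (ht : 0 < t)
    (φ : RSpace d) :
    ∫ ψ, act (kernelK A B ψ s) * act (kernelK A B (φ - ψ) t) = act (kernelK A B φ (s + t)) := by
  obtain ⟨a, b, hA, hB, ha⟩ := h.exists_diag
  have ha' : ∀ i, a i ≠ 0 := fun i h0 => by simpa [h0] using ha i
  have hY := h.isUnit_Y
  have h1 : ∀ ψ : RSpace d, act (kernelK A B ψ s) * act (kernelK A B (φ - ψ) t)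
      = ∑ i, (heatFactor (a i) (b i) s ψ * heatFactor (a i) (b i) t (φ - ψ)) • columnProj Y i := by
    intro ψ
    rw [kernelK_eq hY hA hB ha' hs, kernelK_eq hY hA hB ha' ht]
    refine (map_mul (Matrix.toEuclideanCLM (n := Fin N) (𝕜 := ℂ)) _ _).symm.trans ?_
    rw [conj_diagonal_mul hY]
    exact act_conj_diagonal Y _
  simp_rw [h1]
  rw [integral_finsetSum _ fun i _ => (integrable_heatFactor_mul hs ht (ha i) φ).smul_const _,
    act_kernelK_eq hY hA hB ha' (add_pos hs ht)]
  refine Finset.sum_congr rfl fun i _ => ?_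
  rw [integral_smul_const, integral_heatFactor_mul hs ht (ha i)]

/-- The total mass has eigenvalues $e^{-tb_i}$ in the basis given by $Y$, and these tend to $1$. -/
theorem tendsto_integral_act_kernelK (h : Assumptions A B Y S) :
    Tendsto (fun t : ℝ => ∫ ψ : RSpace d, act (kernelK A B ψ t)) (𝓝[>] 0) (𝓝 1) := by
  obtain ⟨a, b, hA, hB, ha⟩ := h.exists_diag
  have ha' : ∀ i, a i ≠ 0 := fun i h0 => by simpa [h0] using ha i
  have hY := h.isUnit_Y
  have h1 : ∀ t : ℝ, 0 < t → ∫ ψ : RSpace d, act (kernelK A B ψ t)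
      = ∑ i, Complex.exp (-(t * b i)) • columnProj Y i := by
    intro t ht
    simp_rw [act_kernelK_eq hY hA hB ha' ht]
    rw [integral_finsetSum _ fun i _ => (integrable_heatFactor ht (ha i)).smul_const _]
    refine Finset.sum_congr rfl fun i _ => ?_
    rw [integral_smul_const, integral_heatFactor ht (ha i)]
  have h2 : Continuous fun t : ℝ => ∑ i, Complex.exp (-(t * b i)) • columnProj Y i := by
    fun_prop
  have h3 : ∑ i, Complex.exp (-((0 : ℝ) * b i)) • columnProj Y i = 1 := by
    have h4 := act_conj_diagonal Y (fun _ => 1)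
    rw [Matrix.diagonal_one, mul_one,
      Matrix.mul_nonsing_inv Y ((Matrix.isUnit_iff_isUnit_det Y).1 hY)] at h4
    simpa using h4.symm.trans (map_one (Matrix.toEuclideanCLM (n := Fin N) (𝕜 := ℂ)))
  have h5 := (h2.tendsto 0).mono_left (nhdsWithin_le_nhds (s := Ioi 0))
  rw [h3] at h5
  refine h5.congr' ?_
  filter_upwards [self_mem_nhdsWithin] with t ht
  exact (h1 t ht).symm

end KernelBounds

/-! ### Semigroup law and strong continuity on $C_{rub}$ -/

section SemigroupLaw

variable {d N : ℕ} {A B Y : CMat N} {S : RMat d}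

theorem semigroupFun_eq_convolution {t : ℝ} (ht : 0 < t) (v : RSpace d → CSpace N) (x : RSpace d) :
    semigroupFun A B S t v x
      = convolution (fun ψ => act (kernelK A B ψ t)) v
        (ContinuousLinearMap.id ℂ (CSpace N →L[ℂ] CSpace N)) volume (rot S t x) :=
  semigroupFun_eq ht v x

theorem integrable_clm_apply_of_norm_le {Ω E F : Type*} [MeasurableSpace Ω] {μ : Measure Ω}
    [NormedAddCommGroup E] [NormedSpace ℂ E] [NormedAddCommGroup F] [NormedSpace ℂ F]
    {K : Ω → E →L[ℂ] F} (hK : Integrable K μ) {u : Ω → E} (hu : AEStronglyMeasurable u μ) {C : ℝ}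
    (hC : ∀ p, ‖u p‖ ≤ C) : Integrable (fun p => K p (u p)) μ :=
  (hK.norm.mul_const C).mono'
    ((ContinuousLinearMap.apply ℂ F).flip.aestronglyMeasurable_comp₂ hK.aestronglyMeasurable hu)
    (Eventually.of_forall fun p => (K p).le_opNorm_of_le (hC p))

/-- $T(t)v$ is $K_t*v$ composed with $e^{tS}$. Since $K_s$ is radial, the substitution $\psi\mapsto
e^{-tS}\psi$ moves the inner rotation outside, leaving $K_s*(K_t*v)$ at $e^{(s+t)S}x$; associativity
and Chapman–Kolmogorov finish. -/
theorem semigroupFun_semigroupFun (h : Assumptions A B Y S) {s t : ℝ} (hs : 0 < s) (ht : 0 < t)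
    (v : RSpace d →ᵇ CSpace N) (x : RSpace d) :
    semigroupFun A B S s (semigroupFun A B S t v) x = semigroupFun A B S (s + t) v x := by
  have hKs := integrable_kernelK h hs
  have hKt := integrable_kernelK h ht
  set id' := ContinuousLinearMap.id ℂ (CSpace N →L[ℂ] CSpace N)
  -- $v$ is only bounded, so the integrability that Fubini needs must come from the two kernels
  -- alone.
  have hprod := Integrable.convolution_integrand
    (ContinuousLinearMap.mul ℂ (CSpace N →L[ℂ] CSpace N)) hKs hKt
  have hprod' := integrable_clm_apply_of_norm_le hprod
    (u := fun p : RSpace d × RSpace d => v (rot S (s + t) x - p.1))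
    (v.continuous.comp (by fun_prop)).aestronglyMeasurable (fun p => v.norm_coe_le_norm _)
  have hassoc := convolution_assoc' (x₀ := rot S (s + t) x) (k := v)
    (ContinuousLinearMap.mul ℂ (CSpace N →L[ℂ] CSpace N)) id' id' id' (fun _ _ _ => rfl)
    (hKs.ae_convolution_exists _ hKt)
    (Eventually.of_forall fun y => integrable_act_apply hKt v (fun ψ => y - ψ) (by fun_prop))
    hprod'
  have hconv : convolution (fun ψ => act (kernelK A B ψ s)) (fun ψ => act (kernelK A B ψ t))
      (ContinuousLinearMap.mul ℂ (CSpace N →L[ℂ] CSpace N)) volume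
      = fun φ : RSpace d => act (kernelK A B φ (s + t)) :=
    funext fun φ => integral_act_kernelK_mul h hs ht φ
  rw [semigroupFun_eq_convolution (add_pos hs ht), ← hconv, hassoc, semigroupFun_eq hs,
    ← (rotEquiv h.skew_S (-t)).measurePreserving.integral_comp
      (rotEquiv h.skew_S (-t)).toHomeomorph.measurableEmbedding]
  refine integral_congr_ae (Eventually.of_forall fun ψ => ?_)
  change act (kernelK A B (rot S (-t) ψ) s)
    (semigroupFun A B S t v (rot S s x - rot S (-t) ψ)) = act (kernelK A B ψ s) _
  rw [kernelK_rot h.skew_S, semigroupFun_eq_convolution ht, map_sub, rot_rot, rot_rot,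
    add_neg_cancel, rot_zero, add_comm t s]

/-- Half of the exponent yields the factor $e^{-c/t}$ outside radius $\delta$; the other half
remains an integrable Gaussian, with `ε / 2` in place of `ε`. -/
theorem gaussianBound_le_of_le {α ε R β δ t : ℝ} (hα : 0 < α) (hε : 0 < ε) (hδ : 0 ≤ δ)
    (ht : 0 < t) {ψ : RSpace d} (hψ : δ ≤ ‖ψ‖) :
    gaussianBound α ε R β t ψ
      ≤ Real.exp (-(ε * δ ^ 2 / (8 * R ^ 2)) * t⁻¹) * gaussianBound α (ε / 2) R β t ψ := by
  have hpi := Real.pi_pos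
  unfold gaussianBound
  have h1 : -(ε / (4 * t * R ^ 2)) * ‖ψ‖ ^ 2
      = -(ε * ‖ψ‖ ^ 2 / (8 * R ^ 2)) * t⁻¹ + -(ε / 2 / (4 * t * R ^ 2)) * ‖ψ‖ ^ 2 := by
    rcases eq_or_ne R 0 with rfl | hR
    · simp
    field_simp
    ring
  have h2 : Real.exp (-(ε / (4 * t * R ^ 2)) * ‖ψ‖ ^ 2)
      ≤ Real.exp (-(ε * δ ^ 2 / (8 * R ^ 2)) * t⁻¹) *
        Real.exp (-(ε / 2 / (4 * t * R ^ 2)) * ‖ψ‖ ^ 2) := by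
    rw [h1, Real.exp_add]
    gcongr
  refine (mul_le_mul_of_nonneg_left (mul_le_mul_of_nonneg_left h2 (Real.exp_pos _).le)
    (by positivity)).trans_eq ?_
  ring

/-- Split at $|\psi|=\delta$: inside, the oscillation of $v$ is at most $\eta$; outside, it is at
most $2\|v\|$ and the Gaussian tail is small. -/
theorem norm_semigroupFun_sub_integral_le [Nonempty (Fin N)] (h : Assumptions A B Y S) {t : ℝ}
    (ht : 0 < t) (v : RSpace d →ᵇ CSpace N) {δ η : ℝ} (hδ : 0 < δ) (hη : 0 ≤ η)
    (hv : ∀ y z, ‖y - z‖ < δ → ‖v y - v z‖ ≤ η) (x : RSpace d) :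
    ‖semigroupFun A B S t v x - (∫ ψ : RSpace d, act (kernelK A B ψ t)) (v (rot S t x))‖
      ≤ η * (Mb d A Y * Real.exp (omegaB B * t)) +
        2 * ‖v‖ * (condNumber Y * (Real.exp (-(aZero A * δ ^ 2 / (8 * aMax A ^ 2)) * t⁻¹) *
          ((aMax A ^ 2 / (aMin A * (aZero A / 2))) ^ ((d : ℝ) / 2) *
            Real.exp (-bZero B * t)))) := by
  obtain ⟨h1, h2, h3⟩ := h.constants_pos
  have hK := integrable_kernelK h ht
  have hG := integrable_gaussianBound (d := d) (α := aMin A) (β := bZero B) (half_pos h2) h3 ht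
  rw [semigroupFun_eq ht, ContinuousLinearMap.integral_apply hK,
    ← integral_sub (integrable_act_apply hK v (fun ψ => rot S t x - ψ) (by fun_prop))
      (hK.apply_continuousLinearMap _)]
  set q := Real.exp (-(aZero A * δ ^ 2 / (8 * aMax A ^ 2)) * t⁻¹) with hq
  have hbound : ∀ ψ : RSpace d, ‖act (kernelK A B ψ t) (v (rot S t x - ψ))
      - act (kernelK A B ψ t) (v (rot S t x))‖ ≤ η * ‖act (kernelK A B ψ t)‖ +
        2 * ‖v‖ * (condNumber Y *
          (q * gaussianBound (aMin A) (aZero A / 2) (aMax A) (bZero B) t ψ)) := by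
    intro ψ
    have hg0 : 0 ≤ gaussianBound (aMin A) (aZero A / 2) (aMax A) (bZero B) t ψ := by
      have hpi := Real.pi_pos
      unfold gaussianBound
      positivity
    have hc := condNumber_nonneg Y
    rw [← map_sub]
    refine (ContinuousLinearMap.le_opNorm _ _).trans ?_
    rcases lt_or_ge ‖ψ‖ δ with hψ | hψ
    · refine le_add_of_le_of_nonneg ?_ (by positivity)
      rw [mul_comm]
      refine mul_le_mul_of_nonneg_right (hv _ _ ?_) (norm_nonneg _)
      rwa [sub_sub_cancel_left, norm_neg]
    · refine le_add_of_nonneg_of_le (by positivity) ?_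
      rw [mul_comm]
      refine mul_le_mul ?_ ((norm_act_kernelK_le h ht ψ).trans (mul_le_mul_of_nonneg_left
        (gaussianBound_le_of_le h1 h2 hδ.le ht hψ) hc)) (norm_nonneg _) (by positivity)
      rw [two_mul]
      exact (norm_sub_le _ _).trans (add_le_add (v.norm_coe_le_norm _) (v.norm_coe_le_norm _))
  have hi1 := hK.norm.const_mul η
  have hi2 := ((hG.const_mul q).const_mul (condNumber Y)).const_mul (2 * ‖v‖)
  refine (norm_integral_le_of_norm_le (hi1.add hi2) (Eventually.of_forall hbound)).trans ?_
  rw [integral_add' hi1 hi2, integral_const_mul, integral_const_mul, integral_const_mul,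
    integral_const_mul, integral_gaussianBound h1 (half_pos h2) h3 ht]
  gcongr
  exact integral_norm_act_kernelK_le h ht

theorem tendsto_semigroup (h : Assumptions A B Y S) (v : Crub S (CSpace N)) :
    Tendsto (fun t => semigroup h t v) (𝓝[>] 0) (𝓝 v) := by
  rcases isEmpty_or_nonempty (Fin N) with hN | hN
  · have : ∀ u w : Crub S (CSpace N), u = w := fun u w => by
      ext1; ext1 x; exact Subsingleton.elim _ _
    exact tendsto_const_nhds.congr fun t => this _ _
  obtain ⟨h1, h2, h3⟩ := h.constants_pos
  have hM : 0 ≤ Mb d A Y := by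
    have hc := condNumber_nonneg Y
    unfold Mb aOne
    positivity
  rw [Metric.tendsto_nhds]
  intro ε hε
  -- In the limit the errors add up to $\eta M_b$ from the kernel and $\eta$ from the rotation,
  -- strictly below $\eta(M_b+2)=\varepsilon$.
  set η := ε / (Mb d A Y + 2) with hη
  have hη0 : 0 < η := by positivity
  obtain ⟨δ, hδ, H⟩ := Metric.uniformContinuous_iff.1 v.2.1 η hη0
  have hrot := Metric.tendstoUniformly_iff.1 v.2.2 η hη0
  -- $C_{rub}$ controls $v(e^{-tS}x)$ for $t\to0$ from both sides; the rotation $e^{tS}$ needed here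
  -- is the case of time $-t$.
  have hneg : Tendsto (fun t : ℝ => -t) (𝓝[>] 0) (𝓝 0) := by
    simpa using (continuous_neg.tendsto (0 : ℝ)).mono_left (nhdsWithin_le_nhds (s := Ioi 0))
  have hinv : Tendsto (fun t : ℝ => Real.exp (-(aZero A * δ ^ 2 / (8 * aMax A ^ 2)) * t⁻¹))
      (𝓝[>] 0) (𝓝 0) := by
    refine Real.tendsto_exp_atBot.comp ?_
    exact tendsto_inv_nhdsGT_zero.const_mul_atTop_of_neg (neg_neg_of_pos (by positivity))
  have hexp : ∀ c : ℝ, Tendsto (fun t : ℝ => Real.exp (c * t)) (𝓝[>] 0) (𝓝 1) := by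
    intro c
    have : Continuous fun t : ℝ => Real.exp (c * t) := by fun_prop
    simpa using (this.tendsto 0).mono_left (nhdsWithin_le_nhds (s := Ioi 0))
  have hJ := (((tendsto_integral_act_kernelK h).sub_const 1).norm).mul_const ‖v.1‖
  have hF := (((((hexp (omegaB B)).const_mul (Mb d A Y)).const_mul η).add
    (((hinv.mul ((hexp (-bZero B)).const_mul
      ((aMax A ^ 2 / (aMin A * (aZero A / 2))) ^ ((d : ℝ) / 2)))).const_mul
        (condNumber Y)).const_mul (2 * ‖v.1‖))).add hJ).add_const η
  have hlim : η * (Mb d A Y * 1) + 2 * ‖v.1‖ * (condNumber Y * (0 *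
      ((aMax A ^ 2 / (aMin A * (aZero A / 2))) ^ ((d : ℝ) / 2) * 1))) +
      ‖(1 : CSpace N →L[ℂ] CSpace N) - 1‖ * ‖v.1‖ + η < ε := by
    have : ε = η * (Mb d A Y + 2) := by rw [hη]; field_simp
    rw [sub_self, norm_zero, this]
    linarith
  filter_upwards [hF.eventually_lt_const hlim, hneg.eventually hrot, self_mem_nhdsWithin]
    with t htF htrot ht
  have ht' : (0 : ℝ) < t := ht
  refine lt_of_le_of_lt ?_ htF
  rw [dist_eq_norm]
  refine (BoundedContinuousFunction.norm_le_of_nonempty (f := (semigroup h t v - v).1)).2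
    fun x => ?_
  change ‖(semigroup h t v).1 x - v.1 x‖ ≤ _
  rw [semigroup_apply]
  have e1 := norm_semigroupFun_sub_integral_le h ht' v.1 hδ hη0.le
    (fun y z hyz => by
      rw [← dist_eq_norm]; rw [← dist_eq_norm] at hyz; exact (H hyz).le) x
  have e2 : ‖((∫ ψ : RSpace d, act (kernelK A B ψ t)) - 1) (v.1 (rot S t x))‖
      ≤ ‖(∫ ψ : RSpace d, act (kernelK A B ψ t)) - 1‖ * ‖v.1‖ :=
    ContinuousLinearMap.le_opNorm_of_le _ (v.1.norm_coe_le_norm _)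
  have e3 : ‖v.1 (rot S t x) - v.1 x‖ ≤ η := by
    have := htrot x
    rw [neg_neg, dist_comm, dist_eq_norm] at this
    exact this.le
  have e4 : semigroupFun A B S t v.1 x - v.1 x
      = (semigroupFun A B S t v.1 x
          - (∫ ψ : RSpace d, act (kernelK A B ψ t)) (v.1 (rot S t x)))
        + ((∫ ψ : RSpace d, act (kernelK A B ψ t)) - 1) (v.1 (rot S t x))
        + (v.1 (rot S t x) - v.1 x) := by
    rw [sub_apply, one_apply_eq_self]
    abel
  rw [e4]
  exact norm_add₃_le.trans (add_le_add (add_le_add e1 e2) e3)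

theorem isStronglyContinuousSemigroup (h : Assumptions A B Y S) :
    IsStronglyContinuousSemigroup (semigroup h) (Mb d A Y) (omegaB B) where
  zero := by simp [semigroup]
  add s t hs ht v := by
    ext1; ext1 x
    rw [semigroup_apply, semigroup_apply, ← semigroupFun_semigroupFun h hs ht]
    congr 1
    funext y
    exact (semigroup_apply h t v y).symm
  norm_le t ht := by
    refine le_trans ?_ (integral_norm_act_kernelK_le h ht)
    unfold semigroup
    rw [dif_pos ht]
    exact LinearMap.mkContinuous_norm_le _ (integral_nonneg fun _ => norm_nonneg _) _
  tendsto := tendsto_semigroup h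

end SemigroupLaw

end OrnsteinUhlenbeck

/-! ### The resolvent equation -/

theorem corollary6p4 {d N : ℕ} {A B Y : OrnsteinUhlenbeck.CMat N} {S : OrnsteinUhlenbeck.RMat d}
    (h : OrnsteinUhlenbeck.Assumptions A B Y S)
    (lam : ℂ) (hlam : OrnsteinUhlenbeck.omegaB B < lam.re)
    (g : OrnsteinUhlenbeck.Crub S (OrnsteinUhlenbeck.CSpace N)) :
    ∃ v : (OrnsteinUhlenbeck.Ab h).domain,
      -- `v` is the unique solution of the resolvent equation in the domain of the generator
      (lam • (v : OrnsteinUhlenbeck.Crub S (OrnsteinUhlenbeck.CSpace N)) - OrnsteinUhlenbeck.Ab h v = g ∧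
        ∀ w : (OrnsteinUhlenbeck.Ab h).domain,
          lam • (w : OrnsteinUhlenbeck.Crub S (OrnsteinUhlenbeck.CSpace N)) - OrnsteinUhlenbeck.Ab h w = g → w = v) ∧
      -- the Laplace transform formula, as an absolutely convergent integral in `C_rub`
      (IntegrableOn (fun t : ℝ => Complex.exp (-lam * t) • OrnsteinUhlenbeck.semigroup h t g)
          (Ioi 0) ∧
        (v : OrnsteinUhlenbeck.Crub S (OrnsteinUhlenbeck.CSpace N)) =
          ∫ t in Ioi (0 : ℝ), Complex.exp (-lam * t) • OrnsteinUhlenbeck.semigroup h t g) ∧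
      -- the same formula, pointwise and with the heat kernel written out
      (∀ x : OrnsteinUhlenbeck.RSpace d,
        (∀ t : ℝ, 0 < t → Integrable (fun ξ : OrnsteinUhlenbeck.RSpace d =>
          OrnsteinUhlenbeck.act (OrnsteinUhlenbeck.heatKernel A B S x ξ t) (g.1 ξ))) ∧
        IntegrableOn (fun t : ℝ => Complex.exp (-lam * t) •
          ∫ ξ : OrnsteinUhlenbeck.RSpace d,
            OrnsteinUhlenbeck.act (OrnsteinUhlenbeck.heatKernel A B S x ξ t) (g.1 ξ)) (Ioi 0) ∧
        (v : OrnsteinUhlenbeck.Crub S (OrnsteinUhlenbeck.CSpace N)).1 x =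
          ∫ t in Ioi (0 : ℝ), Complex.exp (-lam * t) •
            ∫ ξ : OrnsteinUhlenbeck.RSpace d,
              OrnsteinUhlenbeck.act (OrnsteinUhlenbeck.heatKernel A B S x ξ t) (g.1 ξ)) ∧
      -- the resolvent estimate, in the supremum norm
      ‖(v : OrnsteinUhlenbeck.Crub S (OrnsteinUhlenbeck.CSpace N)).1‖ ≤
        OrnsteinUhlenbeck.Mb d A Y / (lam.re - OrnsteinUhlenbeck.omegaB B) * ‖g.1‖ := by
  have hT := OrnsteinUhlenbeck.isStronglyContinuousSemigroup h
  have hint := hT.integrableOn_exp_smul hlam g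
  have hlim := hT.tendsto_integral_exp_smul hlam g
  obtain ⟨hv, hgen⟩ := OrnsteinUhlenbeck.generator_mem_and_eq hlim
  refine ⟨⟨_, hv⟩, ⟨?_, fun w hw => ?_⟩, ⟨hint, rfl⟩, fun x => ⟨fun t ht =>
    OrnsteinUhlenbeck.integrable_heatKernel h ht g.1 x, ?_⟩,
    hT.norm_integral_exp_smul_le hlam g⟩
  · exact (congrArg _ hgen).trans (sub_sub_cancel _ _)
  -- The difference of two solutions satisfies $A_bu=\lambda u$, hence vanishes.
  · refine Subtype.ext (sub_eq_zero.1 (hT.eq_zero_of_tendsto hlam ?_))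
    have hw' := (OrnsteinUhlenbeck.generator_tendsto _ w).sub hlim
    have heq : lam • ((w : OrnsteinUhlenbeck.Crub S (OrnsteinUhlenbeck.CSpace N)) -
        ∫ t in Ioi (0 : ℝ), Complex.exp (-lam * t) • OrnsteinUhlenbeck.semigroup h t g)
        = OrnsteinUhlenbeck.Ab h w - (lam • (∫ t in Ioi (0 : ℝ),
          Complex.exp (-lam * t) • OrnsteinUhlenbeck.semigroup h t g) - g) := by
      rw [← hw, smul_sub]
      abel
    rw [heq]
    refine hw'.congr fun t => ?_
    rw [map_sub, ← smul_sub]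
    congr 1
    abel
  -- Evaluation at $x$ is bounded and linear on $C_{rub}$, so it commutes with the Bochner integral
  -- and gives the pointwise formula.
  · set E : OrnsteinUhlenbeck.Crub S (OrnsteinUhlenbeck.CSpace N) →L[ℂ]
        OrnsteinUhlenbeck.CSpace N :=
      (BoundedContinuousFunction.evalCLM ℂ x).comp
        (OrnsteinUhlenbeck.Crub S (OrnsteinUhlenbeck.CSpace N)).subtypeL
    have hE : EqOn (fun t : ℝ => E (Complex.exp (-lam * t) • OrnsteinUhlenbeck.semigroup h t g))
        (fun t : ℝ => Complex.exp (-lam * t) • ∫ ξ : OrnsteinUhlenbeck.RSpace d,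
          OrnsteinUhlenbeck.act (OrnsteinUhlenbeck.heatKernel A B S x ξ t) (g.1 ξ)) (Ioi 0) := by
      intro t ht
      change Complex.exp (-lam * t) • (OrnsteinUhlenbeck.semigroup h t g).1 x = _
      rw [OrnsteinUhlenbeck.semigroup_apply, OrnsteinUhlenbeck.semigroupFun, if_pos (mem_Ioi.1 ht)]
    refine ⟨IntegrableOn.congr_fun (E.integrable_comp hint) hE measurableSet_Ioi, ?_⟩
    rw [← setIntegral_congr_fun measurableSet_Ioi hE]
    exact (E.integral_comp_comm hint).symm
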